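/- Theorem 3. For a stream $D=(p_1,\dots,p_m)$ of elements of $\{1,\dots,n\}$ let $f_i=|\{j: p_j=i\}|$ be the frequency of $i$, and, for an integer $k\ge 3$, call $i\in\{1,\dots,n\}$ heavy if $f_i^k>100\sum_{j\ne i}f_j^k$. A (randomized, one-pass) streaming algorithm is given $n$, but not $m$, keeps a bit string as its memory, and reads the elements of the stream once, one after the other; at each element it rewrites its memory as a computable function of $n$, the old memory, the current element and a fresh random number that is uniform on a finite range of computable size; at the end of the stream its output is a computable function of $n$ and its memory. Its space on a stream is the largest number of bits that its memory holds between two elements, in the worst case over the random choices. Let $k\ge 3$ and $a\ge 0$ be integers and let $\varepsilon>0$. There are a one-pass streaming algorithm and a constant $C>0$, both depending only on $k$, $\varepsilon$ and $a$, such that the following holds for all $n\ge 2$ and all streams $D$ of elements of $\{1,\dots,n\}$ of length $m\le n^a$. 1. The algorithm uses at most $C\,n^{1-2/k}\log n$ bits. 2. With probability $1$, it outputs a pair $(i,\tilde f_i)$ with $i\in\{1,\dots,n\}$, $\tilde f_i$ a non-negative integer, and $\tilde f_i\le f_i$. 3. If $i$ is a heavy element of $D$, then with probability at least $2/3$ the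 algorithm outputs this element $i$ together with some $\tilde f_i$ such that $\tilde f_i\ge(1-\varepsilon)f_i$. -/

import Mathlib

/-- The frequency `f_i` of the element `i` in the stream `D`. -/
def frequency (D : List ℕ) (i : ℕ) : ℕ := D.count i

/-- `D` is a stream of elements of `{1, …, n}`. -/
def IsStream (n : ℕ) (D : List ℕ) : Prop := ∀ p ∈ D, p ∈ Finset.Icc 1 n

/-- `i ∈ {1, …, n}` is heavy in `D`: `f_i ^ k > 100 * ∑_{j ≠ i} f_j ^ k`. -/
def IsHeavy (k n : ℕ) (D : List ℕ) (i : ℕ) : Prop :=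
  i ∈ Finset.Icc 1 n ∧
    100 * ∑ j ∈ (Finset.Icc 1 n).erase i, frequency D j ^ k < frequency D i ^ k

/-- A randomized one-pass streaming algorithm, uniform in the universe size `n`.
Its memory is a bit string. When an element `x` of the stream arrives, the algorithm draws a
fresh random number, uniform on a finite range `{0, …, N}` of its choice, and rewrites its memory
as a function of `n`, the old memory, `x` and the random number; it keeps nothing else: neither
the stream, nor its length, nor earlier random numbers can be consulted again. At the end
of the stream (which is not announced) the answer is read off the memory.
All the maps are computable. -/
structure StreamingAlgorithm where
  /-- the initial memory, from `n` -/
  init : ℕ → List Bool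
  /-- the upper end `N` of the range of the random number, from `n`, the memory and the element -/
  range : ℕ × List Bool × ℕ → ℕ
  /-- the new memory, from `n`, the old memory, the element, and the random number -/
  update : (ℕ × List Bool × ℕ) × ℕ → List Bool
  /-- the answer, a pair `(i, f̃_i)`, from `n` and the memory -/
  output : ℕ × List Bool → ℕ × ℕ
  computable_init : Computable init
  computable_range : Computable range
  computable_update : Computable update
  computable_output : Computable output

namespace StreamingAlgorithm

/-- The law of the memory after the arrival of `x`, when it was `w` before. -/
noncomputable def step (A : StreamingAlgorithm) (n : ℕ) (w : List Bool) (x : ℕ) :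
    PMF (List Bool) :=
  (PMF.uniformOfFintype (Fin (A.range (n, w, x) + 1))).map
    fun u => A.update ((n, w, x), (u : ℕ))

/-- The law of the memory after one pass over the stream `D`. -/
noncomputable def run (A : StreamingAlgorithm) (n : ℕ) (D : List ℕ) : PMF (List Bool) :=
  D.foldl (fun μ x => μ.bind fun w => A.step n w x) (PMF.pure (A.init n))

/-- The law of the answer after one pass over the stream `D`. -/
noncomputable def answer (A : StreamingAlgorithm) (n : ℕ) (D : List ℕ) : PMF (ℕ × ℕ) :=
  (A.run n D).map fun w => A.output (n, w)

/-- On the stream `D`, for all outcomes of the random numbers, the memory never holds more than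
`s` bits, at any time of the pass. -/
def UsesAtMostBits (A : StreamingAlgorithm) (n : ℕ) (D : List ℕ) (s : ℝ) : Prop :=
  ∀ D' : List ℕ, D' <+: D → ∀ w ∈ (A.run n D').support, (w.length : ℝ) ≤ s

end StreamingAlgorithm

/-! The space bound allows order of `n ^ (1 - 2/k)` counters of `O(log n)` bits each. A counter
stores an element met in the stream and the number of its arrivals since it was sampled, so it never
overcounts. Class `h` samples every arrival with probability `64 ^ (-h)`; with precision `1 / e` it
serves a heavy `i` whose frequency `f` lies between `28 e * 64 ^ h` and `64 * 28 e * 64 ^ h`. As `m`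
is unknown, all classes run at once.

Let `w` be the width of class `h`. At most `N ^ k` other elements occur, with `N = O(4 ^ w)`, and
interpolation (`sum_pow_le_of_sum_pow_le`) gives `∑ f_j ^ q ≤ 2 N ^ (k - q) f ^ q`. For `q = 1` this
confines the stream to the slots below `8 ^ w` (`HeavyIn.length_lt`); for `q = 3` it limits the
competition (`HeavyIn.sum_freq_sq_le`).

In the block of slots `[8 ^ i, 8 ^ (i + 1))` a row has `2 ^ i` slots, the capacity is proportional
to `2 ^ i`, and the toll due at each row start is proportional to `2 ^ (-i)`. Counters are compared
by their count minus the tolls since birth; those born in the current row compete only with each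
other. All tolls together are at most `7 * 64 ^ h`. By a rising sun lemma (`card_lt_growth_le`), all
but `14 * 64 ^ h` arrivals of `i` are good: from then on `i` arrives at no less than twice the rate
of the tolls. About the first `f / e` arrivals of `i` thus contain at least `14 * 64 ^ h` good
times, and one of these is sampled with probability at least `14 / 15`.

When is a counter born at a good time `u` dropped? An earlier-row arrival `v` of an element of
frequency `F` can match it in row `l` only if the tolls after the row of `v` up to `l` sum to at
most `F`, and if at most `2 F` arrivals of `i` lie between `u` and row `l`. So `v` contributes at
most `2 F ^ 2` to the number of triples `(l, u, v)` weighted by the tolls, in total `2 ∑ f_j ^ 3`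
(`sum_toll_mul_card_oldRivals_le`). Capacity times toll is the same for all rows, so Markov's
inequality applies to all rows at once without a logarithmic loss. Rivals from the row of `u` are
limited by the length of the row. The failure probability stays below `1 / 3` (`card_failure_le`).

Space: once the width has reached its maximum `b`, the slot number falls by the factor 64 from class
to class, so the capacities decrease geometrically and total `O(2 ^ (b (2 k - 4)))`, which is `O(n ^
(1 - 2/k))`. -/

namespace Primrec

/-! ### Primitive recursive arithmetic. -/

variable {α β : Type*} [Primcodable α] [Primcodable β]

theorem list_filter_param {f : α → List β} {p : α → β → Bool} (hf : Primrec f) (hp : Primrec₂ p) :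
    Primrec fun a => (f a).filter (p a) := by
  have h : Primrec fun a => (f a).filterMap (fun b => bif p a b then some b else none) :=
    listFilterMap hf (Primrec.cond hp (Primrec.option_some.comp Primrec.snd) (Primrec.const none))
  refine h.of_eq fun a => ?_
  rw [← List.filterMap_eq_filter]
  congr 1
  funext b
  cases hb : p a b <;> simp [Option.guard, hb]

theorem nat_pow : Primrec₂ ((· ^ ·) : ℕ → ℕ → ℕ) :=
  Primrec₂.unpaired'.1 Nat.Primrec.pow

theorem nat_log (b : ℕ) : Primrec (Nat.log b) := by
  rcases Nat.lt_or_ge 1 b with hb | hb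
  · have h : Primrec fun n => Nat.findGreatest (fun i => b ^ i ≤ n) n :=
      nat_findGreatest Primrec.id
        (Primrec.nat_le.comp (nat_pow.comp (Primrec.const b) Primrec.snd) Primrec.fst)
    refine h.of_eq fun n => ?_
    rcases Nat.eq_zero_or_pos n with rfl | hn
    · simp
    · rw [Nat.findGreatest_eq_iff]
      refine ⟨Nat.log_le_self b n, fun _ => Nat.pow_log_le_self b hn.ne', fun i hi _ => ?_⟩
      exact not_le.2 (Nat.lt_pow_of_log_lt hb hi)
  · refine (Primrec.const 0).of_eq fun n => ?_
    exact (Nat.log_of_left_le_one hb n).symm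

/-- For `1 < b` and `2 ≤ n` the upper logarithm of `n` is one more than the lower logarithm of `n -
1`. -/
theorem nat_clog (b : ℕ) : Primrec (Nat.clog b) := by
  rcases Nat.lt_or_ge 1 b with hb | hb
  · have h : Primrec fun n => Nat.log b (n - 1) + if 2 ≤ n then 1 else 0 :=
      nat_add.comp ((nat_log b).comp (nat_sub.comp Primrec.id (Primrec.const 1)))
        (Primrec.ite (nat_le.comp (Primrec.const 2) Primrec.id) (Primrec.const 1) (Primrec.const 0))
    refine h.of_eq fun n => ?_
    rcases Nat.lt_or_ge n 2 with hn | hn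
    · rw [Nat.clog_of_right_le_one (by omega)]
      have : n - 1 = 0 := by omega
      simp [this, Nat.not_le.2 hn]
    · rw [if_pos hn]
      refine le_antisymm ?_ ?_
      · refine Nat.succ_le_of_lt ?_
        rw [Nat.lt_clog_iff_pow_lt hb]
        have := Nat.pow_log_le_self b (x := n - 1) (by omega)
        omega
      · rw [Nat.clog_le_iff_le_pow hb]
        have := Nat.lt_pow_succ_log_self hb (n - 1)
        simp only [Nat.succ_eq_add_one] at this
        omega
  · exact (Primrec.const 0).of_eq fun n => (Nat.clog_of_left_le_one hb n).symm

end Primrec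

/-! ### A self-delimiting binary code for lists of numbers. -/

namespace Selfdelimiting

/-- The binary digits of `x`, most significant first, each announced by a `true`, and a final
`false`. -/
def encodeNat (x : ℕ) : List Bool :=
  ((List.range (Nat.log 2 x + 1)).flatMap fun i =>
    [true, decide (x / 2 ^ (Nat.log 2 x - i) % 2 = 1)]) ++ [false]

def encode (l : List ℕ) : List Bool := l.flatMap encodeNat

/-- One step of the decoder; the state consists of the decoded numbers, the number that is being
read, and whether the next bit is a digit. -/
def decodeStep (s : List ℕ × ℕ × Bool) (b : Bool) : List ℕ × ℕ × Bool :=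
  bif s.2.2 then (s.1, 2 * s.2.1 + b.toNat, false)
  else bif b then (s.1, s.2.1, true)
  else (s.1 ++ [s.2.1], 0, false)

def decode (w : List Bool) : List ℕ := (w.foldl decodeStep ([], 0, false)).1

theorem length_encodeNat (x : ℕ) : (encodeNat x).length = 2 * Nat.log 2 x + 3 := by
  simp [encodeNat, List.length_flatMap]
  ring

/-- The invariant of the decoder: after `c` leading digits its register holds the number they spell.
Keeping `L` separate from the logarithm of `x` lets the induction run on `c` alone. -/
theorem foldl_decodeStep_digits (x L c : ℕ) (hc : c ≤ L + 1) (hx : x < 2 ^ (L + 1))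
    (out : List ℕ) :
    (((List.range c).flatMap fun i => [true, decide (x / 2 ^ (L - i) % 2 = 1)]).foldl decodeStep
      (out, 0, false)) = (out, x / 2 ^ (L + 1 - c), false) := by
  induction c with
  | zero => simp [Nat.div_eq_of_lt hx]
  | succ c ih =>
    rw [List.range_succ, List.flatMap_append, List.foldl_append, ih (by omega)]
    have h1 : L + 1 - c = (L - c) + 1 := by omega
    have h2 : L + 1 - (c + 1) = L - c := by omega
    rw [h1, h2, pow_succ, ← Nat.div_div_eq_div_mul]
    simp only [List.flatMap_cons, List.flatMap_nil, List.append_nil, List.foldl_cons,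
      List.foldl_nil, decodeStep, cond_false, cond_true, Prod.mk.injEq, true_and, and_true]
    generalize x / 2 ^ (L - c) = y
    rcases Nat.mod_two_eq_zero_or_one y with h | h <;> simp [h] <;> omega

theorem foldl_decodeStep_encodeNat (x : ℕ) (out : List ℕ) :
    (encodeNat x).foldl decodeStep (out, 0, false) = (out ++ [x], 0, false) := by
  rw [encodeNat, List.foldl_append,
    foldl_decodeStep_digits x _ _ le_rfl (Nat.lt_pow_succ_log_self one_lt_two x)]
  simp [decodeStep]

theorem foldl_decodeStep_encode (l out : List ℕ) :
    (encode l).foldl decodeStep (out, 0, false) = (out ++ l, 0, false) := by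
  induction l generalizing out with
  | nil => simp [encode]
  | cons x l ih =>
    have : encode (x :: l) = encodeNat x ++ encode l := by simp [encode]
    rw [this, List.foldl_append, foldl_decodeStep_encodeNat, ih]
    simp

theorem decode_encode (l : List ℕ) : decode (encode l) = l := by
  simp [decode, foldl_decodeStep_encode]

theorem length_encode_le (l : List ℕ) (B : ℕ) (h : ∀ x ∈ l, Nat.log 2 x ≤ B) :
    (encode l).length ≤ l.length * (2 * B + 3) := by
  induction l with
  | nil => simp [encode]
  | cons x l ih =>
    have : encode (x :: l) = encodeNat x ++ encode l := by simp [encode]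
    rw [this, List.length_append, length_encodeNat, List.length_cons, add_one_mul]
    have h1 := h x (by simp)
    have h2 := ih fun y hy => h y (by simp [hy])
    omega

theorem primrec_encodeNat : Primrec encodeNat := by
  have hlog : Primrec fun p : ℕ × ℕ => Nat.log 2 p.1 := (Primrec.nat_log 2).comp Primrec.fst
  have hbit : Primrec fun p : ℕ × ℕ => decide (p.1 / 2 ^ (Nat.log 2 p.1 - p.2) % 2 = 1) := by
    refine PrimrecPred.decide ?_
    refine Primrec.eq.comp ?_ (Primrec.const 1)
    exact Primrec.nat_mod.comp (Primrec.nat_div.comp Primrec.fst (Primrec.nat_pow.comp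
      (Primrec.const 2) (Primrec.nat_sub.comp hlog Primrec.snd))) (Primrec.const 2)
  unfold encodeNat
  refine Primrec.list_append.comp (Primrec.list_flatMap ?_ ?_) (Primrec.const _)
  · exact Primrec.list_range.comp (Primrec.succ.comp (Primrec.nat_log 2))
  · exact Primrec.list_cons.comp (Primrec.const true)
      (Primrec.list_cons.comp hbit (Primrec.const []))

theorem primrec_encode : Primrec encode :=
  Primrec.list_flatMap Primrec.id (primrec_encodeNat.comp Primrec.snd)

theorem primrec_decodeStep : Primrec₂ decodeStep := by
  have hs : Primrec fun p : (List ℕ × ℕ × Bool) × Bool => p.1 := Primrec.fst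
  have h1 := Primrec.fst.comp hs
  have h2 := Primrec.fst.comp (Primrec.snd.comp hs)
  have h3 := Primrec.snd.comp (Primrec.snd.comp hs)
  have hb : Primrec fun p : (List ℕ × ℕ × Bool) × Bool => p.2 := Primrec.snd
  unfold decodeStep
  refine Primrec.cond h3 ?_ (Primrec.cond hb ?_ ?_)
  · exact h1.pair ((Primrec.nat_add.comp (Primrec.nat_mul.comp (Primrec.const 2) h2)
      ((Primrec.dom_bool Bool.toNat).comp hb)).pair (Primrec.const false))
  · exact h1.pair (h2.pair (Primrec.const true))
  · exact (Primrec.list_append.comp h1 (Primrec.list_cons.comp h2 (Primrec.const []))).pair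
      (Primrec.const _)

theorem primrec_decode : Primrec decode :=
  Primrec.fst.comp (Primrec.list_foldl Primrec.id (Primrec.const _)
    (primrec_decodeStep.comp (Primrec.fst.comp Primrec.snd) (Primrec.snd.comp Primrec.snd)).to₂)

end Selfdelimiting

/-! ### The sampler. -/

/-- A counter of the sampler: its class, the sampled element, the number of occurrences since the
sampling, and the row in which the sampling took place. -/
abbrev Counter := ℕ × ℕ × ℕ × ℕ

/-- A counter after the arrival of `x`. -/
def Counter.count (x : ℕ) (y : Counter) : Counter :=
  (y.1, y.2.1, bif decide (y.2.1 = x) then y.2.2.1 + 1 else y.2.2.1, y.2.2.2)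

/-- The constants on which the sampler depends. -/
structure Sampler where
  /-- the exponent of the frequency moment -/
  k : ℕ
  /-- the length of the stream is at most `n ^ a` -/
  a : ℕ
  /-- governs the lengths of the rows -/
  K : ℕ
  /-- governs the capacities -/
  C : ℕ

/-- The first slot of the row to which the time slot `y` belongs: the slots in `[8 ^ i, 8 ^ (i + 1))`
are divided into rows of length `2 ^ i`. -/
def rowStart (y : ℕ) : ℕ := y / 2 ^ Nat.log 8 y * 2 ^ Nat.log 8 y

namespace Sampler

variable (S : Sampler)

/-- The least `A` with `n ≤ 4 ^ (k A)`. -/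
def base (n : ℕ) : ℕ := Nat.clog (4 ^ S.k) n

/-- The largest class. The counters of class `h` aim at the frequencies of order `64 ^ h`. -/
def top (n : ℕ) : ℕ := S.a * S.k * S.base n

/-- Up to a constant, `4 ^ width` is the `k`-th root of a bound on the number of other elements
beside a heavy one of frequency about `64 ^ h`: this number is at most `n`, and at most the `k`-th
power of the heavy frequency. -/
def width (n h : ℕ) : ℕ := min (3 * h) (S.base n)

/-- The length of a time slot in class `h`. -/
def slotLength (n h : ℕ) : ℕ := S.K * 64 ^ h * 2 ^ (S.width n h * (2 * S.k - 5))

/-- The last rows multiply this by about `2 ^ width`, which yields the exponent `2 k - 4` of the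
space bound. The same factor in the slot length makes `8 ^ width` slots cover time `K * 64 ^ h * 4 ^
(width * (k - 1))`, enough for the stream of a heavy element. -/
def minCapacity (n h : ℕ) : ℕ := S.C * 2 ^ (S.width n h * (2 * S.k - 5))

/-- The number of counters of class `h` allowed in the time slot `y`. -/
def capacity (n h y : ℕ) : ℕ :=
  if y < 8 ^ S.width n h then S.minCapacity n h * 2 ^ Nat.log 8 y else 0

/-- The toll of class `h` to be paid when the time slot `y` begins. -/
def toll (n h y : ℕ) : ℕ :=
  if y % 2 ^ Nat.log 8 y = 0 then 4 ^ (3 * h - S.width n h) * 2 ^ (S.width n h - Nat.log 8 y) else 0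

/-- The total toll of class `h` in the time slots `1, …, y`. -/
def totalToll (n h y : ℕ) : ℕ := ∑ z ∈ Finset.range y, S.toll n h (z + 1)

/-- The row, in class `h`, of time `τ`. -/
def row (n h τ : ℕ) : ℕ := rowStart (τ / S.slotLength n h)

/-- The rank of a counter; the toll paid before its birth is credited. -/
def rank (n : ℕ) (y : Counter) : ℕ := y.2.2.1 + S.totalToll n y.1 y.2.2.2

/-- `z` competes with `y` and is at least as good, at time `τ`. Only counters of the same class
compete, and the counters born in the current row do not compete with the older ones. -/
def beats (n τ : ℕ) (y z : Counter) : Bool :=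
  (decide (z.1 = y.1) &&
    (decide (z.2.2.2 = S.row n y.1 τ) == decide (y.2.2.2 = S.row n y.1 τ))) &&
    decide (S.rank n y ≤ S.rank n z)

/-- The counters that are born at time `τ`, when `x` arrives and the random number is `u`. -/
def births (n τ x u : ℕ) : List Counter :=
  ((List.range (S.top n + 1)).filter fun h => decide (u % 64 ^ h = 0)).map
    fun h => (h, x, 1, S.row n h τ)

/-- The selection at time `τ`. -/
def select (n τ : ℕ) (l : List Counter) : List Counter :=
  l.filter fun y => decide ((l.filter (S.beats n τ y)).length ≤
    S.capacity n y.1 (τ / S.slotLength n y.1))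

/-- The state of the sampler consists of the time and the counters. -/
def advance (n : ℕ) (s : ℕ × List Counter) (x u : ℕ) : ℕ × List Counter :=
  (s.1 + 1, S.select n s.1 (s.2.map (Counter.count x) ++ S.births n s.1 x u))

/-- The element of a largest counter, and this counter. -/
def best (l : List Counter) : ℕ × ℕ :=
  l.foldl (fun o y => bif decide (o.2 < y.2.2.1) then (y.2.1, y.2.2.1) else o) (1, 0)

end Sampler

/-! ### States of the sampler as bit strings. -/

namespace Counter

def toNat (y : Counter) : ℕ := Nat.pair y.1 (Nat.pair y.2.1 (Nat.pair y.2.2.1 y.2.2.2))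

def ofNat (c : ℕ) : Counter :=
  (c.unpair.1, c.unpair.2.unpair.1, c.unpair.2.unpair.2.unpair.1, c.unpair.2.unpair.2.unpair.2)

theorem ofNat_toNat (y : Counter) : ofNat (toNat y) = y := by
  simp [ofNat, toNat]

/-- The bit string that represents a state of the sampler. -/
def toBits (s : ℕ × List Counter) : List Bool :=
  Selfdelimiting.encode (s.1 :: s.2.map toNat)

def ofBits (w : List Bool) : ℕ × List Counter :=
  ((Selfdelimiting.decode w).headI, (Selfdelimiting.decode w).tail.map ofNat)

theorem ofBits_toBits (s : ℕ × List Counter) : ofBits (toBits s) = s := by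
  simp [ofBits, toBits, Selfdelimiting.decode_encode, Function.comp_def, ofNat_toNat]

theorem primrec_toBits : Primrec toBits := by
  have h : Primrec toNat := by
    unfold toNat
    exact Primrec₂.natPair.comp Primrec.fst (Primrec₂.natPair.comp (Primrec.fst.comp Primrec.snd)
      (Primrec₂.natPair.comp (Primrec.fst.comp (Primrec.snd.comp Primrec.snd))
        (Primrec.snd.comp (Primrec.snd.comp Primrec.snd))))
  exact Selfdelimiting.primrec_encode.comp (Primrec.list_cons.comp Primrec.fst
    (Primrec.list_map Primrec.snd (h.comp Primrec.snd).to₂))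

theorem primrec_ofBits : Primrec ofBits := by
  have h1 : Primrec fun c : ℕ => c.unpair.1 := Primrec.fst.comp Primrec.unpair
  have h2 : Primrec fun c : ℕ => c.unpair.2 := Primrec.snd.comp Primrec.unpair
  have h : Primrec ofNat :=
    h1.pair ((h1.comp h2).pair ((h1.comp (h2.comp h2)).pair (h2.comp (h2.comp h2))))
  exact (Primrec.list_headI.comp Selfdelimiting.primrec_decode).pair
    (Primrec.list_map (Primrec.list_tail.comp Selfdelimiting.primrec_decode)
      (h.comp Primrec.snd).to₂)

theorem primrec_count : Primrec₂ count := by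
  have hx : Primrec fun p : ℕ × Counter => p.1 := Primrec.fst
  have hy : Primrec fun p : ℕ × Counter => p.2 := Primrec.snd
  have h1 := Primrec.fst.comp hy
  have h2 := Primrec.fst.comp (Primrec.snd.comp hy)
  have h3 := Primrec.fst.comp (Primrec.snd.comp (Primrec.snd.comp hy))
  have h4 := Primrec.snd.comp (Primrec.snd.comp (Primrec.snd.comp hy))
  exact h1.pair (h2.pair ((Primrec.cond (Primrec.eq.comp h2 hx).decide
    (Primrec.succ.comp h3) h3).pair h4))

end Counter

namespace Sampler

variable (S : Sampler)

/-! ### Computability of the sampler. -/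

section Primrec

variable {α : Type*} [Primcodable α] {n h τ x u y : α → ℕ}

theorem primrec_base (hn : Primrec n) : Primrec fun i => S.base (n i) :=
  (Primrec.nat_clog _).comp hn

theorem primrec_top (hn : Primrec n) : Primrec fun i => S.top (n i) :=
  Primrec.nat_mul.comp (Primrec.const _) (S.primrec_base hn)

theorem primrec_width (hn : Primrec n) (hh : Primrec h) : Primrec fun i => S.width (n i) (h i) :=
  Primrec.nat_min.comp (Primrec.nat_mul.comp (Primrec.const 3) hh) (S.primrec_base hn)

theorem primrec_slotLength (hn : Primrec n) (hh : Primrec h) :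
    Primrec fun i => S.slotLength (n i) (h i) :=
  Primrec.nat_mul.comp (Primrec.nat_mul.comp (Primrec.const _)
    (Primrec.nat_pow.comp (Primrec.const 64) hh)) (Primrec.nat_pow.comp (Primrec.const 2)
      (Primrec.nat_mul.comp (S.primrec_width hn hh) (Primrec.const _)))

theorem primrec_minCapacity (hn : Primrec n) (hh : Primrec h) :
    Primrec fun i => S.minCapacity (n i) (h i) :=
  Primrec.nat_mul.comp (Primrec.const _) (Primrec.nat_pow.comp (Primrec.const 2)
      (Primrec.nat_mul.comp (S.primrec_width hn hh) (Primrec.const _)))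

theorem primrec_capacity (hn : Primrec n) (hh : Primrec h) (hy : Primrec y) :
    Primrec fun i => S.capacity (n i) (h i) (y i) :=
  Primrec.ite (Primrec.nat_lt.comp hy (Primrec.nat_pow.comp (Primrec.const 8)
    (S.primrec_width hn hh))) (Primrec.nat_mul.comp (S.primrec_minCapacity hn hh)
      (Primrec.nat_pow.comp (Primrec.const 2) ((Primrec.nat_log 8).comp hy))) (Primrec.const 0)

theorem primrec_toll (hn : Primrec n) (hh : Primrec h) (hy : Primrec y) :
    Primrec fun i => S.toll (n i) (h i) (y i) := by
  have hlog := (Primrec.nat_log 8).comp hy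
  have hw := S.primrec_width hn hh
  refine Primrec.ite (Primrec.eq.comp (Primrec.nat_mod.comp hy
    (Primrec.nat_pow.comp (Primrec.const 2) hlog)) (Primrec.const 0)) ?_ (Primrec.const 0)
  exact Primrec.nat_mul.comp (Primrec.nat_pow.comp (Primrec.const 4)
    (Primrec.nat_sub.comp (Primrec.nat_mul.comp (Primrec.const 3) hh) hw))
    (Primrec.nat_pow.comp (Primrec.const 2) (Primrec.nat_sub.comp hw hlog))

theorem primrec_totalToll (hn : Primrec n) (hh : Primrec h) (hy : Primrec y) :
    Primrec fun i => S.totalToll (n i) (h i) (y i) := by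
  have hs : Primrec₂ fun (i : α) (p : ℕ × ℕ) => p.2 + S.toll (n i) (h i) (p.1 + 1) :=
    Primrec.nat_add.comp (Primrec.snd.comp Primrec.snd)
      (S.primrec_toll (hn.comp Primrec.fst) (hh.comp Primrec.fst)
        (Primrec.succ.comp (Primrec.fst.comp Primrec.snd)))
  refine (Primrec.nat_rec' hy (Primrec.const 0) hs).of_eq fun i => ?_
  unfold totalToll
  induction y i with
  | zero => rfl
  | succ z ih => rw [Finset.sum_range_succ, ← ih]

theorem primrec_row (hn : Primrec n) (hh : Primrec h) (hτ : Primrec τ) :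
    Primrec fun i => S.row (n i) (h i) (τ i) := by
  have hy := Primrec.nat_div.comp hτ (S.primrec_slotLength hn hh)
  have hp := Primrec.nat_pow.comp (Primrec.const 2) ((Primrec.nat_log 8).comp hy)
  exact Primrec.nat_mul.comp (Primrec.nat_div.comp hy hp) hp

theorem primrec_rank {y : α → Counter} (hn : Primrec n) (hy : Primrec y) :
    Primrec fun i => S.rank (n i) (y i) :=
  Primrec.nat_add.comp (Primrec.fst.comp (Primrec.snd.comp (Primrec.snd.comp hy)))
    (S.primrec_totalToll hn (Primrec.fst.comp hy)
      (Primrec.snd.comp (Primrec.snd.comp (Primrec.snd.comp hy))))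

theorem primrec_beats {y z : α → Counter} (hn : Primrec n) (hτ : Primrec τ) (hy : Primrec y)
    (hz : Primrec z) : Primrec fun i => S.beats (n i) (τ i) (y i) (z i) := by
  have hr := S.primrec_row hn (Primrec.fst.comp hy) hτ
  have hb {v : α → Counter} (hv : Primrec v) :
      Primrec fun i => decide ((v i).2.2.2 = S.row (n i) (y i).1 (τ i)) :=
    (Primrec.eq.comp (Primrec.snd.comp (Primrec.snd.comp (Primrec.snd.comp hv))) hr).decide
  exact Primrec.and.comp (Primrec.and.comp
    (Primrec.eq.comp (Primrec.fst.comp hz) (Primrec.fst.comp hy)).decide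
    (Primrec.beq.comp (hb hz) (hb hy)))
    (Primrec.nat_le.comp (S.primrec_rank hn hy) (S.primrec_rank hn hz)).decide

theorem primrec_births (hn : Primrec n) (hτ : Primrec τ) (hx : Primrec x) (hu : Primrec u) :
    Primrec fun i => S.births (n i) (τ i) (x i) (u i) := by
  refine Primrec.list_map (Primrec.list_filter_param
    (Primrec.list_range.comp (Primrec.succ.comp (S.primrec_top hn))) ?_) ?_
  · exact (Primrec.eq.comp (Primrec.nat_mod.comp (hu.comp Primrec.fst)
      (Primrec.nat_pow.comp (Primrec.const 64) Primrec.snd)) (Primrec.const 0)).decide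
  · exact Primrec.snd.pair ((hx.comp Primrec.fst).pair ((Primrec.const 1).pair
      (S.primrec_row (hn.comp Primrec.fst) Primrec.snd (hτ.comp Primrec.fst))))

theorem primrec_select {l : α → List Counter} (hn : Primrec n) (hτ : Primrec τ) (hl : Primrec l) :
    Primrec fun i => S.select (n i) (τ i) (l i) := by
  refine Primrec.list_filter_param hl ?_
  have hn' : Primrec fun p : α × Counter => n p.1 := hn.comp Primrec.fst
  have hτ' : Primrec fun p : α × Counter => τ p.1 := hτ.comp Primrec.fst
  have hc : Primrec fun p : α × Counter => p.2.1 := Primrec.fst.comp Primrec.snd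
  refine (Primrec.nat_le.comp (Primrec.list_length.comp (Primrec.list_filter_param
    (hl.comp Primrec.fst) ?_)) ?_).decide
  · exact S.primrec_beats (hn'.comp Primrec.fst) (hτ'.comp Primrec.fst)
      (Primrec.snd.comp Primrec.fst) Primrec.snd
  · exact S.primrec_capacity hn' hc (Primrec.nat_div.comp hτ' (S.primrec_slotLength hn' hc))

theorem primrec_advance {s : α → ℕ × List Counter} (hn : Primrec n) (hs : Primrec s)
    (hx : Primrec x) (hu : Primrec u) : Primrec fun i => S.advance (n i) (s i) (x i) (u i) := by
  have hτ := Primrec.fst.comp hs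
  exact (Primrec.succ.comp hτ).pair (S.primrec_select hn hτ (Primrec.list_append.comp
    (Primrec.list_map (Primrec.snd.comp hs)
      (Counter.primrec_count.comp (hx.comp Primrec.fst) Primrec.snd).to₂)
    (S.primrec_births hn hτ hx hu)))

theorem primrec_best : Primrec best := by
  have ho : Primrec fun p : List Counter × (ℕ × ℕ) × Counter => p.2.1 :=
    Primrec.fst.comp Primrec.snd
  have hy : Primrec fun p : List Counter × (ℕ × ℕ) × Counter => p.2.2 :=
    Primrec.snd.comp Primrec.snd
  have hc := Primrec.fst.comp (Primrec.snd.comp (Primrec.snd.comp hy))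
  exact Primrec.list_foldl Primrec.id (Primrec.const (1, 0))
    (Primrec.cond (Primrec.nat_lt.comp (Primrec.snd.comp ho) hc).decide
      ((Primrec.fst.comp (Primrec.snd.comp hy)).pair hc) ho).to₂

end Primrec

/-- The streaming algorithm that runs the sampler. -/
def algorithm : StreamingAlgorithm where
  init _ := Counter.toBits (0, [])
  -- The number of random values is `64 ^ top`, which every `64 ^ h` with `h ≤ top` divides, so
  -- births have probability exactly `64 ^ (-h)`.
  range p := 64 ^ S.top p.1 - 1
  update p := Counter.toBits (S.advance p.1.1 (Counter.ofBits p.1.2.1) p.1.2.2 p.2)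
  output p := best (Counter.ofBits p.2).2
  computable_init := Computable.const _
  computable_range := (Primrec.nat_sub.comp (Primrec.nat_pow.comp (Primrec.const 64)
    (S.primrec_top Primrec.fst)) (Primrec.const 1)).to_comp
  computable_update := by
    have h1 : Primrec fun p : (ℕ × List Bool × ℕ) × ℕ => p.1 := Primrec.fst
    have h2 := Primrec.snd.comp h1
    exact (Counter.primrec_toBits.comp (S.primrec_advance (Primrec.fst.comp h1)
      (Counter.primrec_ofBits.comp (Primrec.fst.comp h2)) (Primrec.snd.comp h2)
      Primrec.snd)).to_comp
  computable_output := (primrec_best.comp (Primrec.snd.comp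
    (Counter.primrec_ofBits.comp Primrec.snd))).to_comp

end Sampler

/-! ### The random choices of a run as one uniform vector. -/

theorem PMF.uniformOfFintype_pi_succ (α : Type) [Fintype α] [Nonempty α] (m : ℕ) :
    PMF.uniformOfFintype (Fin (m + 1) → α) =
      (PMF.uniformOfFintype (Fin m → α)).bind fun ω =>
        (PMF.uniformOfFintype α).map fun a => Fin.snoc (α := fun _ => α) ω a := by
  classical
  ext ω'
  simp only [PMF.bind_apply, PMF.map_apply, PMF.uniformOfFintype_apply, tsum_fintype]
  rw [Finset.sum_eq_single (Fin.init ω'), Finset.sum_eq_single (ω' (Fin.last m))]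
  · simp only [Fin.snoc_init_self, if_true]
    rw [← ENNReal.mul_inv (Or.inr (by simp)) (Or.inr (by simp))]
    simp [pow_succ]
  · intro a _ ha
    rw [if_neg]
    rintro h
    apply ha
    rw [h]
    simp
  · simp
  · intro ω _ hω
    rw [Finset.sum_eq_zero, mul_zero]
    intro a _
    rw [if_neg]
    rintro h
    apply hω
    rw [h]
    simp
  · simp

namespace Sampler

variable (S : Sampler) (n : ℕ)

/-- The state after `T` steps, for the stream `x 0, x 1, …` and the random numbers `ω 0, ω 1, …`. -/
def state (x ω : ℕ → ℕ) : ℕ → ℕ × List Counter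
  | 0 => (0, [])
  | T + 1 => S.advance n (state x ω T) (x T) (ω T)

theorem state_congr {x ω ω' : ℕ → ℕ} {T : ℕ} (h : ∀ t < T, ω t = ω' t) :
    S.state n x ω T = S.state n x ω' T := by
  induction T with
  | zero => rfl
  | succ T ih => rw [state, state, ih fun t ht => h t (by omega), h T (by omega)]

/-- The random numbers are drawn from `{0, …, maxRandom}`. -/
def maxRandom : ℕ := 64 ^ S.top n - 1

def extend {m N : ℕ} (ω : Fin m → Fin (N + 1)) (t : ℕ) : ℕ :=
  if h : t < m then (ω ⟨t, h⟩ : ℕ) else 0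

/-- The range of the draws depends on `n` alone, not on the memory; this is what makes a whole run a
function of a uniform vector. -/
theorem step_eq (w : List Bool) (x : ℕ) : S.algorithm.step n w x =
    (PMF.uniformOfFintype (Fin (S.maxRandom n + 1))).map
      fun u : Fin (S.maxRandom n + 1) => S.algorithm.update ((n, w, x), (u : ℕ)) := by
  change PMF.map (fun u : ℕ => S.algorithm.update ((n, w, x), u))
    ((PMF.uniformOfFintype (Fin (S.maxRandom n + 1))).bind fun u => PMF.pure (u : ℕ)) = _
  rw [PMF.map_bind]
  simp only [PMF.pure_map]
  rfl

theorem run_eq (x : ℕ → ℕ) (m : ℕ) :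
    S.algorithm.run n ((List.range m).map x) =
      (PMF.uniformOfFintype (Fin m → Fin (S.maxRandom n + 1))).map
        fun ω => Counter.toBits (S.state n x (extend ω) m) := by
  induction m with
  | zero =>
    have : (fun ω : Fin 0 → Fin (S.maxRandom n + 1) =>
        Counter.toBits (S.state n x (extend ω) 0)) =
        Function.const _ (Counter.toBits (0, [])) := rfl
    rw [this, PMF.map_const]
    rfl
  | succ m ih =>
    have h : S.algorithm.run n ((List.range (m + 1)).map x) =
        (S.algorithm.run n ((List.range m).map x)).bind
          fun w => S.algorithm.step n w (x m) := by
      rw [List.range_succ, List.map_append, StreamingAlgorithm.run, List.foldl_append]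
      rfl
    rw [h, ih, PMF.bind_map, PMF.uniformOfFintype_pi_succ, PMF.map_bind]
    congr 1
    funext ω
    rw [PMF.map_comp]
    rw [Function.comp_apply, step_eq]
    congr 1
    funext u
    simp only [Function.comp_apply, algorithm, Counter.ofBits_toBits, state]
    congr 1
    have h1 : extend (Fin.snoc (α := fun _ => Fin (S.maxRandom n + 1)) ω u) m = u := by
      simp [extend, Fin.snoc]
    rw [h1]
    congr 1
    -- The state after `m` steps does not see the new last coordinate.
    refine S.state_congr n fun t ht => ?_
    simp [extend, Fin.snoc, ht, Nat.lt_succ_of_lt ht]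

/-- The law of the answer, in terms of a uniform vector of random numbers. -/
theorem answer_eq (x : ℕ → ℕ) (m : ℕ) :
    S.algorithm.answer n ((List.range m).map x) =
      (PMF.uniformOfFintype (Fin m → Fin (S.maxRandom n + 1))).map
        fun ω => best (S.state n x (extend ω) m).2 := by
  rw [StreamingAlgorithm.answer, run_eq, PMF.map_comp]
  congr 1
  funext ω
  simp [algorithm, Counter.ofBits_toBits]

theorem state_fst (x ω : ℕ → ℕ) (T : ℕ) : (S.state n x ω T).1 = T := by
  induction T with
  | zero => rfl
  | succ T ih => rw [state, advance, ih]

/-- The number of `w ∈ [u, T)` with `x w = x u`. -/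
def occ (x : ℕ → ℕ) (u T : ℕ) : ℕ := ((Finset.Ico u T).filter fun w => x w = x u).card

theorem occ_succ {x : ℕ → ℕ} {u T : ℕ} (h : u ≤ T) :
    occ x u (T + 1) = bif decide (x u = x T) then occ x u T + 1 else occ x u T := by
  unfold occ
  rw [← Finset.insert_Ico_right_eq_Ico_add_one h, Finset.filter_insert]
  by_cases hx : x u = x T
  · rw [if_pos hx.symm, Finset.card_insert_of_notMem (by simp)]
    simp [hx]
  · rw [if_neg fun h => hx h.symm]
    simp [hx]

theorem occ_self_succ (x : ℕ → ℕ) (u : ℕ) : occ x u (u + 1) = 1 := by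
  rw [occ_succ le_rfl]
  simp [occ]

/-! ### Comparison with the process that drops nothing. -/

/-- What has become, after `T` steps, of the counter of class `h` born at time `u`, if it has never
been dropped. -/
def counter (x : ℕ → ℕ) (T u h : ℕ) : Counter := (h, x u, occ x u T, S.row n h u)

/-- The counters after `T` steps if none is ever dropped. -/
def allCounters (x ω : ℕ → ℕ) (T : ℕ) : List Counter :=
  (List.range T).flatMap fun u =>
    ((List.range (S.top n + 1)).filter fun h => decide (ω u % 64 ^ h = 0)).map
      fun h => S.counter n x T u h

theorem count_counter (x : ℕ → ℕ) {T u : ℕ} (h : ℕ) (hu : u < T) :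
    (S.counter n x T u h).count (x T) = S.counter n x (T + 1) u h := by
  simp only [Counter.count, counter, occ_succ hu.le]
  rfl

theorem allCounters_succ (x ω : ℕ → ℕ) (T : ℕ) :
    S.allCounters n x ω (T + 1) =
      (S.allCounters n x ω T).map (Counter.count (x T)) ++ S.births n T (x T) (ω T) := by
  unfold allCounters
  rw [List.range_succ (n := T), List.flatMap_append, List.map_flatMap]
  congr 1
  · refine List.flatMap_congr fun u hu => ?_
    rw [List.map_map]
    refine List.map_congr_left fun h _ => ?_
    rw [Function.comp_apply, count_counter _ _ _ _ (List.mem_range.1 hu)]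
  · simp [births, counter, occ_self_succ]

/-- The counters at time `T` before the selection. -/
def candidates (x ω : ℕ → ℕ) (T : ℕ) : List Counter :=
  (S.state n x ω T).2.map (Counter.count (x T)) ++ S.births n T (x T) (ω T)

theorem state_succ_snd (x ω : ℕ → ℕ) (T : ℕ) :
    (S.state n x ω (T + 1)).2 = S.select n T (S.candidates n x ω T) := by
  rw [state, advance, state_fst]
  rfl

/-- The selection compares lengths of lists, with multiplicity, hence sublists rather than subsets.
-/
theorem state_sublist (x ω : ℕ → ℕ) (T : ℕ) :
    (S.state n x ω T).2.Sublist (S.allCounters n x ω T) := by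
  induction T with
  | zero => simp [state]
  | succ T ih =>
    rw [state_succ_snd, allCounters_succ]
    exact List.filter_sublist.trans ((ih.map _).append (List.Sublist.refl _))

theorem candidates_sublist (x ω : ℕ → ℕ) (T : ℕ) :
    (S.candidates n x ω T).Sublist (S.allCounters n x ω (T + 1)) := by
  rw [allCounters_succ]
  exact ((S.state_sublist n x ω T).map _).append (List.Sublist.refl _)

theorem mem_allCounters {x ω : ℕ → ℕ} {T : ℕ} {y : Counter} (hy : y ∈ S.allCounters n x ω T) :
    ∃ u < T, ∃ h ≤ S.top n, y = S.counter n x T u h := by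
  simp only [allCounters, List.mem_flatMap, List.mem_map, List.mem_filter, List.mem_range] at hy
  obtain ⟨u, hu, h, ⟨hh, -⟩, rfl⟩ := hy
  exact ⟨u, hu, h, by omega, rfl⟩

/-- The times before `T` when a counter of class `h` is born. -/
def hits (ω : ℕ → ℕ) (h T : ℕ) : Finset ℕ := (Finset.range T).filter fun v => ω v % 64 ^ h = 0

theorem length_filter_range_eq_le {p : ℕ → Bool} {h N : ℕ} (hp : ∀ i, p i = true → i = h) :
    ((List.range N).filter p).length ≤ if p h then 1 else 0 := by
  have hsub : ((List.range N).filter p).Sublist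
      ((List.range N).filter fun i => decide (i = h)) := by
    refine List.monotone_filter_right _ fun i hi => ?_
    simp [hp i hi]
  split_ifs with hh
  · refine hsub.length_le.trans ?_
    rw [← List.countP_eq_length_filter]
    have : List.countP (fun i => decide (i = h)) (List.range N) = (List.range N).count h := by
      rw [List.count]
      exact List.countP_congr fun i _ => by simp
    rw [this]
    exact List.nodup_iff_count_le_one.1 List.nodup_range h
  · simp only [nonpos_iff_eq_zero, List.length_eq_zero_iff, List.filter_eq_nil_iff]
    intro i _ hi
    exact hh (hp i hi ▸ hi)

/-- One arrival gives birth to at most one counter of each class, so counters of class `h` may be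
counted by their birth times. -/
theorem length_filter_allCounters_le (x ω : ℕ → ℕ) (T h : ℕ) (p : Counter → Bool)
    (hp : ∀ y, p y = true → y.1 = h) :
    ((S.allCounters n x ω T).filter p).length ≤
      ((hits ω h T).filter fun v => p (S.counter n x T v h) = true).card := by
  have hsum (l : List ℕ) : ((l.flatMap fun u =>
      ((List.range (S.top n + 1)).filter fun h => decide (ω u % 64 ^ h = 0)).map
        fun h => S.counter n x T u h).filter p).length ≤
      (l.filter fun v => decide (ω v % 64 ^ h = 0 ∧ p (S.counter n x T v h) = true)).length := by
    induction l with
    | nil => simp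
    | cons u l ih =>
      rw [List.flatMap_cons, List.filter_append, List.length_append, List.filter_cons]
      have h1 : ((((List.range (S.top n + 1)).filter fun h => decide (ω u % 64 ^ h = 0)).map
          fun h => S.counter n x T u h).filter p).length ≤
          if ω u % 64 ^ h = 0 ∧ p (S.counter n x T u h) = true then 1 else 0 := by
        rw [List.filter_map, List.length_map, List.filter_filter]
        refine (length_filter_range_eq_le (h := h) ?_).trans ?_
        · intro i hi
          simp only [Function.comp_apply, Bool.and_eq_true] at hi
          exact hp _ hi.1
        · simp [and_comm]
      by_cases hc : ω u % 64 ^ h = 0 ∧ p (S.counter n x T u h) = true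
      · rw [if_pos hc] at h1
        rw [if_pos (decide_eq_true hc), List.length_cons]
        omega
      · rw [if_neg hc] at h1
        rw [if_neg fun hd => hc (of_decide_eq_true hd)]
        omega
  refine (hsum _).trans (le_of_eq ?_)
  rw [hits, Finset.filter_filter]
  rfl

/-- A counter survives if at no time too many counters that might ever exist are better. -/
theorem counter_mem_state (x ω : ℕ → ℕ) {u h : ℕ} (hh : h ≤ S.top n) (hω : ω u % 64 ^ h = 0)
    {m : ℕ} (hm : ∀ T, u ≤ T → T < m →
      ((hits ω h (T + 1)).filter fun v => S.beats n T (S.counter n x (T + 1) u h)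
        (S.counter n x (T + 1) v h) = true).card ≤ S.capacity n h (T / S.slotLength n h))
    (hu : u < m) : S.counter n x m u h ∈ (S.state n x ω m).2 := by
  induction m with
  | zero => omega
  | succ m ih =>
    rw [state_succ_snd, select, List.mem_filter]
    constructor
    · rcases Nat.lt_or_ge u m with hum | hum
      · have := ih (fun T h1 h2 => hm T h1 (by omega)) hum
        rw [← count_counter _ _ _ _ hum]
        exact List.mem_append_left _ (List.mem_map_of_mem this)
      · obtain rfl : u = m := by omega
        refine List.mem_append_right _ ?_
        simp only [births, List.mem_map, List.mem_filter, List.mem_range, decide_eq_true_eq]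
        exact ⟨h, ⟨by omega, hω⟩, by simp [counter, occ_self_succ]⟩
    · refine decide_eq_true ?_
      refine le_trans ?_ (hm m (by omega) (by omega))
      refine le_trans ?_ (S.length_filter_allCounters_le n x ω (m + 1) h _ ?_)
      · exact ((S.candidates_sublist n x ω m).filter _).length_le
      · intro y hy
        simp only [beats, Bool.and_eq_true, decide_eq_true_eq] at hy
        exact hy.1.1

/-! ### The answer -/

theorem best_mem_or (l : List Counter) :
    best l = (1, 0) ∨ ∃ y ∈ l, best l = (y.2.1, y.2.2.1) := by
  suffices H : ∀ o : ℕ × ℕ, l.foldl (fun o y => bif decide (o.2 < y.2.2.1) then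
      (y.2.1, y.2.2.1) else o) o = o ∨ ∃ y ∈ l, l.foldl (fun o y =>
        bif decide (o.2 < y.2.2.1) then (y.2.1, y.2.2.1) else o) o = (y.2.1, y.2.2.1) from H _
  induction l with
  | nil => simp
  | cons y l ih =>
    intro o
    rw [List.foldl_cons]
    rcases ih (bif decide (o.2 < y.2.2.1) then (y.2.1, y.2.2.1) else o) with h | ⟨z, hz, h⟩
    · rw [h]
      by_cases hc : o.2 < y.2.2.1
      · exact Or.inr ⟨y, by simp, by simp [hc]⟩
      · exact Or.inl (by simp [hc])
    · exact Or.inr ⟨z, by simp [hz], h⟩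

theorem le_best {l : List Counter} {y : Counter} (hy : y ∈ l) : y.2.2.1 ≤ (best l).2 := by
  suffices H : ∀ o : ℕ × ℕ, o.2 ≤ (l.foldl (fun o y => bif decide (o.2 < y.2.2.1) then
      (y.2.1, y.2.2.1) else o) o).2 ∧ ∀ y ∈ l, y.2.2.1 ≤ (l.foldl (fun o y =>
        bif decide (o.2 < y.2.2.1) then (y.2.1, y.2.2.1) else o) o).2 from (H _).2 y hy
  clear hy
  induction l with
  | nil => simp
  | cons z l ih =>
    intro o
    rw [List.foldl_cons]
    obtain ⟨h1, h2⟩ := ih (bif decide (o.2 < z.2.2.1) then (z.2.1, z.2.2.1) else o)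
    have h3 : o.2 ≤ (bif decide (o.2 < z.2.2.1) then (z.2.1, z.2.2.1) else o).2 ∧
        z.2.2.1 ≤ (bif decide (o.2 < z.2.2.1) then (z.2.1, z.2.2.1) else o).2 := by
      by_cases hc : o.2 < z.2.2.1
      · simp [hc]; omega
      · simp [hc]; omega
    refine ⟨h3.1.trans h1, fun y hy => ?_⟩
    rcases List.mem_cons.1 hy with rfl | hy
    · exact h3.2.trans h1
    · exact h2 y hy

/-- The frequency of `j` among `x 0, …, x (m - 1)`. -/
def freq (x : ℕ → ℕ) (m j : ℕ) : ℕ := ((Finset.range m).filter fun w => x w = j).card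

theorem occ_le_freq (x : ℕ → ℕ) (u m : ℕ) : occ x u m ≤ freq x m (x u) := by
  refine Finset.card_le_card (Finset.filter_subset_filter _ fun w hw => ?_)
  simp only [Finset.mem_Ico, Finset.mem_range] at hw ⊢
  exact hw.2

theorem best_state (x ω : ℕ → ℕ) (m : ℕ) :
    best (S.state n x ω m).2 = (1, 0) ∨
      ∃ u < m, (best (S.state n x ω m).2).1 = x u ∧
        (best (S.state n x ω m).2).2 ≤ freq x m (x u) := by
  rcases best_mem_or (S.state n x ω m).2 with h | ⟨y, hy, h⟩
  · exact Or.inl h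
  · obtain ⟨u, hu, c, -, rfl⟩ := S.mem_allCounters n ((S.state_sublist n x ω m).subset hy)
    refine Or.inr ⟨u, hu, ?_⟩
    rw [h]
    exact ⟨rfl, occ_le_freq x u m⟩

end Sampler

/-! ### Rows -/

theorem rowStart_le (y : ℕ) : rowStart y ≤ y := Nat.div_mul_le_self _ _

theorem pow_log_dvd_rowStart (y : ℕ) : 2 ^ Nat.log 8 y ∣ rowStart y := Dvd.intro_left _ rfl

theorem lt_rowStart_add (y : ℕ) : y < rowStart y + 2 ^ Nat.log 8 y := by
  have := Nat.div_add_mod y (2 ^ Nat.log 8 y)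
  have h2 := Nat.mod_lt y (show 0 < 2 ^ Nat.log 8 y by positivity)
  rw [mul_comm] at this
  unfold rowStart
  omega

/-- `8 ^ i` is a multiple of `2 ^ i`, so rounding down to a row start does not leave the block.
Therefore all slots of a row have the same capacity. -/
theorem pow_log_le_rowStart {y : ℕ} (hy : y ≠ 0) : 8 ^ Nat.log 8 y ≤ rowStart y := by
  unfold rowStart
  rw [show (8 : ℕ) = 4 * 2 by norm_num, mul_pow]
  refine Nat.mul_le_mul_right _ ?_
  rw [Nat.le_div_iff_mul_le (by positivity), ← mul_pow]
  exact Nat.pow_log_le_self _ hy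

theorem log_rowStart (y : ℕ) : Nat.log 8 (rowStart y) = Nat.log 8 y := by
  rcases Nat.eq_zero_or_pos y with rfl | hy
  · simp [rowStart]
  · refine Nat.log_eq_of_pow_le_of_lt_pow (pow_log_le_rowStart hy.ne') ?_
    exact (rowStart_le y).trans_lt (Nat.lt_pow_succ_log_self (by norm_num) y)

theorem rowStart_mono : Monotone rowStart := by
  intro y z h
  rcases (Nat.log_mono_right (b := 8) h).eq_or_lt with he | hl
  · unfold rowStart
    rw [he]
    exact Nat.mul_le_mul_right _ (Nat.div_le_div_right h)
  · have h1 : y < 8 ^ Nat.log 8 z := Nat.lt_pow_of_log_lt (by norm_num) hl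
    have hz : z ≠ 0 := by rintro rfl; simp at hl
    exact ((rowStart_le y).trans h1.le).trans (pow_log_le_rowStart hz)

namespace Sampler

variable (S : Sampler) (n : ℕ)

theorem row_mono (h : ℕ) : Monotone (S.row n h) :=
  fun _ _ hτ => rowStart_mono (Nat.div_le_div_right hτ)

theorem width_le (h : ℕ) : S.width n h ≤ 3 * h := min_le_left _ _

theorem four_pow_mul (h : ℕ) : 4 ^ (3 * h - S.width n h) * 4 ^ S.width n h = 64 ^ h := by
  rw [← pow_add, Nat.sub_add_cancel (S.width_le n h), pow_mul]
  norm_num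

/-- From one block to the next the capacity doubles and the toll is halved. The constant product
turns division by the capacity of a row into weighting by its toll. -/
theorem capacity_mul_toll {h y : ℕ} (hy : y < 8 ^ S.width n h) :
    S.capacity n h (rowStart y) * S.toll n h (rowStart y) =
      S.minCapacity n h * (4 ^ (3 * h - S.width n h) * 2 ^ S.width n h) := by
  have hlog : Nat.log 8 y ≤ S.width n h := by
    rcases Nat.eq_zero_or_pos y with rfl | h0
    · simp
    · exact ((Nat.log_lt_iff_lt_pow (by norm_num) h0.ne').2 hy).le
  rw [capacity, toll, if_pos ((rowStart_le y).trans_lt hy), log_rowStart,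
    if_pos (Nat.mod_eq_zero_of_dvd (pow_log_dvd_rowStart y))]
  have : (2 : ℕ) ^ S.width n h = 2 ^ Nat.log 8 y * 2 ^ (S.width n h - Nat.log 8 y) := by
    rw [← pow_add]; congr 1; omega
  rw [this]
  ring

theorem totalToll_mono (h : ℕ) : Monotone (S.totalToll n h) := fun _ _ hy =>
  Finset.sum_le_sum_of_subset (Finset.range_mono hy)

/-- Block `i` has `7 * 8 ^ i` slots, hence `7 * 4 ^ i` rows, each with a toll proportional to `2 ^
(-i)`. The block totals form a geometric series of ratio 2. -/
theorem totalToll_pow_le (h i : ℕ) (hi : i ≤ S.width n h) :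
    S.totalToll n h (8 ^ i - 1) ≤
      7 * (4 ^ (3 * h - S.width n h) * 2 ^ S.width n h) * 2 ^ i := by
  induction i with
  | zero => simp [totalToll]
  | succ i ih =>
    have h8 : 8 ^ i ≤ 8 ^ (i + 1) := Nat.pow_le_pow_right (by norm_num) (by omega)
    have hpos : 0 < 8 ^ i := by positivity
    have hsplit : S.totalToll n h (8 ^ (i + 1) - 1) = S.totalToll n h (8 ^ i - 1) +
        ∑ z ∈ Finset.Ico (8 ^ i) (8 ^ (i + 1)), S.toll n h z := by
      have hs (m : ℕ) (hm : 0 < m) : S.totalToll n h (m - 1) =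
          ∑ z ∈ Finset.Ico 1 m, S.toll n h z := by
        rw [Finset.sum_Ico_eq_sum_range]
        simp only [totalToll, add_comm]
      rw [hs _ (by positivity), hs _ hpos, Finset.sum_Ico_consecutive _ hpos h8]
    have hnew : ∑ z ∈ Finset.Ico (8 ^ i) (8 ^ (i + 1)), S.toll n h z ≤
        7 * (4 ^ (3 * h - S.width n h) * 2 ^ S.width n h) * 2 ^ i := by
      have h1 : ∀ z ∈ Finset.Ico (8 ^ i) (8 ^ (i + 1)), S.toll n h z =
          if z % 2 ^ i = 0 then 4 ^ (3 * h - S.width n h) * 2 ^ (S.width n h - i) else 0 := by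
        intro z hz
        rw [Finset.mem_Ico] at hz
        rw [toll, Nat.log_eq_of_pow_le_of_lt_pow hz.1 hz.2]
      rw [Finset.sum_congr rfl h1, ← Finset.sum_filter, Finset.sum_const, smul_eq_mul]
      have hcard : ((Finset.Ico (8 ^ i) (8 ^ (i + 1))).filter fun z => z % 2 ^ i = 0).card ≤
          7 * 4 ^ i := by
        have : (7 : ℕ) * 4 ^ i = (Finset.Ico (4 ^ i) (8 * 4 ^ i)).card := by
          rw [Nat.card_Ico]; omega
        rw [this]
        have e : (8 : ℕ) ^ i = 4 ^ i * 2 ^ i := by rw [← mul_pow]; norm_num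
        refine Finset.card_le_card_of_injOn (fun z => z / 2 ^ i) ?_ ?_
        · intro z hz
          simp only [Finset.coe_filter, Finset.mem_Ico, Set.mem_ofPred_eq] at hz
          simp only [Finset.coe_Ico, Set.mem_Ico]
          constructor
          · rw [Nat.le_div_iff_mul_le (by positivity), ← e]
            exact hz.1.1
          · rw [Nat.div_lt_iff_lt_mul (by positivity)]
            calc z < 8 ^ (i + 1) := hz.1.2
              _ = 8 * 4 ^ i * 2 ^ i := by rw [pow_succ, e]; ring
        · intro z hz z' hz' hzz
          simp only [Finset.coe_filter, Finset.mem_Ico, Set.mem_ofPred_eq] at hz hz'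
          have a1 := Nat.div_add_mod z (2 ^ i)
          have a2 := Nat.div_add_mod z' (2 ^ i)
          simp only at hzz
          rw [← a1, ← a2, hz.2, hz'.2, hzz]
      refine (Nat.mul_le_mul_right _ hcard).trans (le_of_eq ?_)
      have e2 : (2 : ℕ) ^ S.width n h = 2 ^ i * 2 ^ (S.width n h - i) := by
        rw [← pow_add]; congr 1; omega
      have e4 : (4 : ℕ) ^ i = 2 ^ i * 2 ^ i := by rw [← mul_pow]; norm_num
      rw [e2, e4]
      ring
    rw [hsplit, pow_succ 2, ← mul_assoc]
    have := ih (by omega)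
    omega

theorem totalToll_le {h y : ℕ} (hy : y < 8 ^ S.width n h) : S.totalToll n h y ≤ 7 * 64 ^ h := by
  refine (S.totalToll_mono n h (show y ≤ 8 ^ S.width n h - 1 by omega)).trans ?_
  refine (S.totalToll_pow_le n h _ le_rfl).trans (le_of_eq ?_)
  rw [← S.four_pow_mul n h, show (4 : ℕ) ^ S.width n h = 2 ^ S.width n h * 2 ^ S.width n h by
    rw [← mul_pow]; norm_num]
  ring

theorem sum_toll_Ioc (h y z : ℕ) (hyz : y ≤ z) :
    ∑ l ∈ Finset.Ioc y z, S.toll n h l + S.totalToll n h y = S.totalToll n h z := by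
  have hs (m : ℕ) : S.totalToll n h m = ∑ l ∈ Finset.Ioc 0 m, S.toll n h l := by
    rw [totalToll, Finset.range_eq_Ico, ← Finset.sum_Ico_add_right_sub_eq 0 m 1]
    simp only [zero_add]
    have : Finset.Ico 1 (m + 1) = Finset.Ioc 0 m := by ext; simp [Nat.succ_le_iff]
    rw [this]
    refine Finset.sum_congr rfl fun l hl => ?_
    rw [Nat.sub_add_cancel (Finset.mem_Ioc.1 hl).1]
  rw [hs, hs, add_comm, ← Finset.sum_union]
  · rw [Finset.Ioc_union_Ioc_eq_Ioc (Nat.zero_le _) hyz]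
  · exact Finset.Ioc_disjoint_Ioc_of_le le_rfl

/-! ### Space -/

/-- Every survivor, itself included, beats the survivor of lowest rank, and that one is beaten at
most `c` times. Ties therefore never push the number of survivors above the capacity. -/
theorem length_filter_rank_le {α : Type*} (l : List α) (p q : α → Bool) (f : α → ℕ)
    (b : α → α → Bool) (c : ℕ) (hb : ∀ y z, p y = true → p z = true → f y ≤ f z → b y z = true)
    (hq : ∀ y, p y = true → q y = true → (l.filter (b y)).length ≤ c) :
    (l.filter fun y => p y && q y).length ≤ c := by
  by_cases hne : (l.filter fun y => p y && q y) = []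
  · simp [hne]
  · obtain ⟨y, hy, hmin⟩ : ∃ y ∈ (l.filter fun y => p y && q y),
        ∀ z ∈ (l.filter fun y => p y && q y), f y ≤ f z := by
      generalize (l.filter fun y => p y && q y) = l' at hne
      induction l' with
      | nil => exact absurd rfl hne
      | cons y l' ih =>
        by_cases hl' : l' = []
        · exact ⟨y, by simp, by simp [hl']⟩
        · obtain ⟨z, hz, hzm⟩ := ih hl'
          rcases le_total (f y) (f z) with h | h
          · refine ⟨y, by simp, fun w hw => ?_⟩
            rcases List.mem_cons.1 hw with rfl | hw
            · exact le_rfl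
            · exact h.trans (hzm w hw)
          · refine ⟨z, by simp [hz], fun w hw => ?_⟩
            rcases List.mem_cons.1 hw with rfl | hw
            · exact h
            · exact hzm w hw
    have hy' := List.mem_filter.1 hy
    simp only [Bool.and_eq_true] at hy'
    refine le_trans ?_ (hq y hy'.2.1 hy'.2.2)
    have : (l.filter fun y => p y && q y) =
        (l.filter fun y => p y && q y).filter (b y) := by
      symm
      rw [List.filter_eq_self]
      intro z hz
      have hz' := List.mem_filter.1 hz
      simp only [Bool.and_eq_true] at hz'
      exact hb y z hy'.2.1 hz'.2.1 (hmin z hz)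
    rw [this]
    exact (List.filter_sublist.filter _).length_le

/-- The factor 2 is for the two separate competitions, among the counters born in the current row
and among the older ones. -/
theorem length_select_class_le (T h : ℕ) (l : List Counter) :
    ((S.select n T l).filter fun y => decide (y.1 = h)).length ≤
      2 * S.capacity n h (T / S.slotLength n h) := by
  have hpart (c : Bool) : ((S.select n T l).filter fun y => decide (y.1 = h) &&
      (decide (y.2.2.2 = S.row n h T) == c)).length ≤ S.capacity n h (T / S.slotLength n h) := by
    rw [select, List.filter_filter]
    refine length_filter_rank_le l _ _ (S.rank n) (S.beats n T) _ ?_ ?_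
    · intro y z hy hz hf
      simp only [Bool.and_eq_true, decide_eq_true_eq, beq_iff_eq] at hy hz
      obtain ⟨rfl, hy⟩ := hy
      simp only [beats, Bool.and_eq_true, decide_eq_true_eq, beq_iff_eq]
      exact ⟨⟨hz.1, by rw [hy, hz.2]⟩, hf⟩
    · intro y hy hq
      simp only [Bool.and_eq_true, decide_eq_true_eq] at hy hq
      rw [hy.1] at hq
      exact hq
  have h2 : ((S.select n T l).filter fun y => decide (y.1 = h)).length =
      ((S.select n T l).filter fun y => decide (y.1 = h) &&
        (decide (y.2.2.2 = S.row n h T) == true)).length +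
      ((S.select n T l).filter fun y => decide (y.1 = h) &&
        (decide (y.2.2.2 = S.row n h T) == false)).length := by
    induction S.select n T l with
    | nil => rfl
    | cons y l ih =>
      simp only [List.filter_cons]
      by_cases a : y.1 = h <;> by_cases b : y.2.2.2 = S.row n h T <;> simp [a, b] at ih ⊢ <;> omega
  have := hpart true
  have := hpart false
  omega

theorem length_eq_sum_classes (l : List Counter) (N : ℕ) (hl : ∀ y ∈ l, y.1 < N) :
    l.length = ∑ h ∈ Finset.range N, (l.filter fun y => decide (y.1 = h)).length := by
  induction l with
  | nil => simp
  | cons y l ih =>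
    have h1 : ∀ h, ((y :: l).filter fun y => decide (y.1 = h)).length =
        (if y.1 = h then 1 else 0) + (l.filter fun y => decide (y.1 = h)).length := by
      intro h
      rw [List.filter_cons]
      by_cases a : y.1 = h <;> simp [a, add_comm]
    simp only [h1]
    rw [Finset.sum_add_distrib, ← ih fun z hz => hl z (by simp [hz]), Finset.sum_ite_eq,
      if_pos (Finset.mem_range.2 (hl y (by simp))), List.length_cons, add_comm]

/-- Dividing by 64 lowers the logarithm to base 8 by 2, so the terms drop by the factor 4 until they
reach 1. -/
theorem sum_pow_log_le (Y N : ℕ) :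
    ∑ h ∈ Finset.range N, 2 ^ Nat.log 8 (Y / 64 ^ h) ≤ 2 * 2 ^ Nat.log 8 Y + N := by
  induction N generalizing Y with
  | zero => simp
  | succ N ih =>
    rw [Finset.sum_range_succ']
    have h1 : ∀ h, Y / 64 ^ (h + 1) = Y / 64 / 64 ^ h := fun h => by
      rw [Nat.div_div_eq_div_mul, pow_succ, mul_comm]
    simp only [h1, pow_zero, Nat.div_one]
    have h2 := ih (Y / 64)
    have h3 : Nat.log 8 (Y / 64) = Nat.log 8 Y - 1 - 1 := by
      rw [show Y / 64 = Y / 8 / 8 by rw [Nat.div_div_eq_div_mul], Nat.log_div_base,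
        Nat.log_div_base]
    rcases Nat.lt_or_ge (Nat.log 8 Y) 2 with hl | hl
    · have h4 : Nat.log 8 (Y / 64) = 0 := by omega
      rw [h4] at h2
      have : 1 ≤ 2 ^ Nat.log 8 Y := Nat.one_le_two_pow
      omega
    · have h4 : (2 : ℕ) ^ Nat.log 8 Y = 4 * 2 ^ Nat.log 8 (Y / 64) := by
        rw [h3, show (4 : ℕ) = 2 ^ 2 by norm_num, ← pow_add]
        congr 1
        omega
      omega

/-- The classes whose slots are exhausted contribute nothing and are peeled off; the first remaining
slot is below `8 ^ b`. Hence the bound is uniform in the time. -/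
theorem sum_pow_log_ite_le (Y N b : ℕ) :
    ∑ h ∈ Finset.range N, (if Y / 64 ^ h < 8 ^ b then 2 ^ Nat.log 8 (Y / 64 ^ h) else 0) ≤
      2 * 2 ^ b + N := by
  induction N generalizing Y with
  | zero => simp
  | succ N ih =>
    rcases Nat.lt_or_ge Y (8 ^ b) with hY | hY
    · have h1 : 2 ^ Nat.log 8 Y ≤ 2 ^ b := by
        refine Nat.pow_le_pow_right (by norm_num) ?_
        rcases Nat.eq_zero_or_pos Y with rfl | h0
        · simp
        · exact ((Nat.log_lt_iff_lt_pow (by norm_num) h0.ne').2 hY).le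
      refine (Finset.sum_le_sum fun h _ => ?_).trans
        ((sum_pow_log_le Y (N + 1)).trans (by omega))
      split_ifs <;> simp
    · rw [Finset.sum_range_succ']
      have h1 : ∀ h, Y / 64 ^ (h + 1) = Y / 64 / 64 ^ h := fun h => by
        rw [Nat.div_div_eq_div_mul, pow_succ, mul_comm]
      simp only [h1, pow_zero, Nat.div_one]
      rw [if_neg (not_lt.2 hY)]
      have := ih (Y / 64)
      omega

theorem sum_pow_ite_le (N b : ℕ) :
    ∑ h ∈ Finset.range N, (if 3 * h ≤ b then 2 ^ (3 * h) else 0) ≤ 2 * 2 ^ b := by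
  rw [← Finset.sum_filter]
  have h1 : ∑ h ∈ (Finset.range N).filter (fun h => 3 * h ≤ b), 2 ^ (3 * h) =
      ∑ j ∈ ((Finset.range N).filter (fun h => 3 * h ≤ b)).image (3 * ·), 2 ^ j := by
    rw [Finset.sum_image]
    intro i _ j _ hij
    simpa using hij
  rw [h1, ← pow_succ']
  refine (Nat.geomSum_lt le_rfl ?_).le
  simp only [Finset.mem_image, Finset.mem_filter]
  rintro _ ⟨h, ⟨-, hh⟩, rfl⟩
  omega

theorem sum_capacity_le (hk : 3 ≤ S.k) (T : ℕ) :
    ∑ h ∈ Finset.range (S.top n + 1), S.capacity n h (T / S.slotLength n h) ≤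
      S.C * (S.a * S.k + 5) * 2 ^ (S.base n * (2 * S.k - 4)) := by
  set b := S.base n with hb
  set Y := T / (S.K * 2 ^ (b * (2 * S.k - 5))) with hY
  have hpt : ∀ h, S.capacity n h (T / S.slotLength n h) ≤ S.C * 2 ^ (b * (2 * S.k - 5)) *
      ((if 3 * h ≤ b then 2 ^ (3 * h) else 0) +
        if Y / 64 ^ h < 8 ^ b then 2 ^ Nat.log 8 (Y / 64 ^ h) else 0) := by
    intro h
    rcases Nat.lt_or_ge b (3 * h) with hh | hh
    · have hw : S.width n h = b := min_eq_right hh.le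
      have hy : T / S.slotLength n h = Y / 64 ^ h := by
        rw [slotLength, hw, hY, Nat.div_div_eq_div_mul]
        congr 1
        ring
      rw [capacity, minCapacity, hw, hy, if_neg (not_le.2 hh), zero_add]
      split_ifs <;> simp
    · have hw : S.width n h = 3 * h := min_eq_left hh
      rw [if_pos hh]
      refine le_trans ?_ (Nat.mul_le_mul_left _ (Nat.le_add_right _ _))
      rw [capacity, minCapacity, hw]
      split_ifs with hc
      · refine Nat.mul_le_mul (Nat.mul_le_mul_left _ (Nat.pow_le_pow_right (by norm_num)
          (Nat.mul_le_mul_right _ hh))) (Nat.pow_le_pow_right (by norm_num) ?_)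
        rcases Nat.eq_zero_or_pos (T / S.slotLength n h) with h0 | h0
        · simp [h0]
        · exact ((Nat.log_lt_iff_lt_pow (by norm_num) h0.ne').2 hc).le
      · exact Nat.zero_le _
  refine (Finset.sum_le_sum fun h _ => hpt h).trans ?_
  rw [← Finset.mul_sum, Finset.sum_add_distrib]
  have h1 := sum_pow_ite_le (S.top n + 1) b
  have h2 := sum_pow_log_ite_le Y (S.top n + 1) b
  -- The number of classes is linear in `b`, and `2 ^ b` absorbs it: no extra logarithm arises.
  have h3 : S.top n ≤ S.a * S.k * 2 ^ b :=
    Nat.mul_le_mul_left _ (Nat.lt_two_pow_self).le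
  have h4 : 1 ≤ 2 ^ b := Nat.one_le_two_pow
  calc _ ≤ S.C * 2 ^ (b * (2 * S.k - 5)) * ((S.a * S.k + 5) * 2 ^ b) := by
        refine Nat.mul_le_mul_left _ ?_
        rw [add_mul]
        omega
    _ = _ := by
        have : b * (2 * S.k - 4) = b * (2 * S.k - 5) + b := by
          rw [show 2 * S.k - 4 = (2 * S.k - 5) + 1 by omega]; ring
        rw [this, pow_add]
        ring

theorem length_state_le (hk : 3 ≤ S.k) (x ω : ℕ → ℕ) (T : ℕ) :
    (S.state n x ω T).2.length ≤
      2 * (S.C * (S.a * S.k + 5) * 2 ^ (S.base n * (2 * S.k - 4))) := by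
  rcases T with - | T
  · simp [state]
  · rw [length_eq_sum_classes _ (S.top n + 1)]
    · refine le_trans (Finset.sum_le_sum (g := fun h =>
        2 * S.capacity n h (T / S.slotLength n h)) fun h _ => ?_) ?_
      · rw [state_succ_snd]
        exact S.length_select_class_le n T h _
      · rw [← Finset.mul_sum]
        exact Nat.mul_le_mul_left _ (S.sum_capacity_le n hk T)
    · intro y hy
      obtain ⟨u, -, h, hh, rfl⟩ := S.mem_allCounters n ((S.state_sublist n x ω _).subset hy)
      exact Nat.lt_succ_of_le hh

theorem le_pow_base (hk : 3 ≤ S.k) : n ≤ 4 ^ (S.k * S.base n) := by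
  rw [pow_mul]
  exact Nat.le_pow_clog (Nat.one_lt_pow (by omega) (by norm_num)) n

theorem occ_le (x : ℕ → ℕ) (u T : ℕ) : occ x u T ≤ T := by
  refine (Finset.card_filter_le _ _).trans ?_
  rw [Nat.card_Ico]
  omega

theorem pair_lt_two_pow {c d B : ℕ} (hc : c < 2 ^ B) (hd : d < 2 ^ B) :
    Nat.pair c d < 2 ^ (2 * B) := by
  refine (Nat.pair_lt_max_add_one_sq c d).trans_le ?_
  rw [mul_comm, pow_mul]
  refine Nat.pow_le_pow_left ?_ 2
  have := max_lt hc hd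
  omega

theorem length_toBits_le (hk : 3 ≤ S.k) (x ω : ℕ → ℕ) (T : ℕ) (hx : ∀ t < T, x t ≤ n)
    (hT : T ≤ n ^ S.a) (hn : 2 ≤ n) :
    (Counter.toBits (S.state n x ω T)).length ≤
      (2 * S.C * (S.a * S.k + 5) + 1) * 2 ^ (S.base n * (2 * S.k - 4)) *
        ((32 * S.k * (S.a + 1) + 19) * S.base n) := by
  set b := S.base n with hb
  -- The time and all four fields of a counter are below `2 ^ B`. The innermost pairing stays below
  -- `2 ^ (2 B)`, and each of the two outer ones doubles the exponent again, up to `8 B`.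
  set B := 2 * S.k * (S.a + 1) * b + 1 with hB
  have hn4 := S.le_pow_base n hk
  have hb1 : 1 ≤ b := Nat.one_le_iff_ne_zero.2 fun h0 => by
    rw [← hb, h0] at hn4; simp at hn4; omega
  have hpow {e N : ℕ} (hN : N ≤ 4 ^ (S.k * b * e)) (he : e ≤ S.a + 1) : N < 2 ^ B := by
    refine hN.trans_lt ?_
    rw [show (4 : ℕ) = 2 ^ 2 by norm_num, ← pow_mul]
    refine Nat.pow_lt_pow_right (by norm_num) ?_
    rw [hB]
    have := Nat.mul_le_mul_left (2 * (S.k * b)) he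
    have e1 : 2 * (S.k * b) * (S.a + 1) = 2 * S.k * (S.a + 1) * b := by ring
    have e2 : 2 * (S.k * b) * e = 2 * (S.k * b * e) := by ring
    omega
  have hT' : T ≤ 4 ^ (S.k * b * S.a) := by
    rw [pow_mul]
    exact hT.trans (Nat.pow_le_pow_left hn4 _)
  have hTB : T < 2 ^ B := hpow hT' (by omega)
  have hlen := S.length_state_le n hk x ω T
  rw [Counter.toBits]
  refine (Selfdelimiting.length_encode_le _ (8 * B) ?_).trans ?_
  · intro c hc
    rw [state_fst] at hc
    suffices c < 2 ^ (8 * B) by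
      rcases Nat.eq_zero_or_pos c with rfl | h0
      · simp
      · exact ((Nat.log_lt_iff_lt_pow one_lt_two h0.ne').2 this).le
    rcases List.mem_cons.1 hc with rfl | hc
    · exact hTB.trans_le (Nat.pow_le_pow_right (by norm_num) (by omega))
    · obtain ⟨y, hy, rfl⟩ := List.mem_map.1 hc
      obtain ⟨u, hu, h, hh, rfl⟩ := S.mem_allCounters n ((S.state_sublist n x ω _).subset hy)
      have h1 : h < 2 ^ B := by
        refine hpow (e := S.a) ?_ (by omega)
        refine hh.trans ?_
        rw [top, show S.k * b * S.a = S.a * S.k * b by ring]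
        exact (Nat.lt_pow_self (by norm_num)).le
      have h2 : x u < 2 ^ B := by
        refine hpow (e := 1) ?_ (by omega)
        rw [mul_one]
        exact (hx u hu).trans hn4
      have h3 : occ x u T < 2 ^ B := (occ_le x u T).trans_lt hTB
      have h4 : S.row n h u < 2 ^ B :=
        ((rowStart_le _).trans (Nat.div_le_self _ _)).trans_lt (hu.trans hTB)
      have h5 := pair_lt_two_pow h3 h4
      have h6 := pair_lt_two_pow (h2.trans_le (Nat.pow_le_pow_right (by norm_num)
        (show B ≤ 2 * B by omega))) h5
      have h7 := pair_lt_two_pow (h1.trans_le (Nat.pow_le_pow_right (by norm_num)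
        (show B ≤ 2 * (2 * B) by omega))) h6
      rw [show 8 * B = 2 * (2 * (2 * B)) by ring]
      exact h7
  · rw [List.length_cons, List.length_map]
    refine Nat.mul_le_mul ?_ ?_
    · have : 1 ≤ 2 ^ (b * (2 * S.k - 4)) := Nat.one_le_two_pow
      calc _ ≤ 2 * (S.C * (S.a * S.k + 5) * 2 ^ (b * (2 * S.k - 4))) +
            2 ^ (b * (2 * S.k - 4)) := add_le_add hlen this
        _ = _ := by ring
    · rw [hB]
      have : 2 * (8 * (2 * S.k * (S.a + 1) * b + 1)) + 3 =
        32 * S.k * (S.a + 1) * b + 19 := by ring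
      rw [this, add_mul]
      omega

end Sampler

/-! ### Combinatorics of finite sets of natural numbers -/

open Classical in
/-- A discrete rising sun lemma: for a monotone `g`, few elements `u` of `I` are such that some
interval `[u, T]` contains less elements of `I` than the growth of `g`. -/
theorem card_lt_growth_le (I : Finset ℕ) (g : ℕ → ℕ) (hg : Monotone g) (m G : ℕ)
    (hG : ∀ t < m, g t ≤ G) :
    (I.filter fun u => ∃ T, u ≤ T ∧ T < m ∧
      (I.filter fun w => u ≤ w ∧ w ≤ T).card + g u < g T).card ≤ G := by
  classical
  set bad := I.filter fun u => ∃ T, u ≤ T ∧ T < m ∧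
      (I.filter fun w => u ≤ w ∧ w ≤ T).card + g u < g T with hbad
  have hlt : ∀ u ∈ bad, u < m := by
    intro u hu
    obtain ⟨T, h1, h2, -⟩ := (Finset.mem_filter.1 hu).2
    omega
  have hend : ∀ a, m ≤ a → (bad.filter fun u => a ≤ u).card = 0 := by
    intro a ha
    rw [Finset.card_eq_zero, Finset.filter_eq_empty_iff]
    intro u hu hau
    have := hlt u hu
    omega
  -- Induction from the right end. At a bad point `a` with witness `T`, the members of `I` in `[a,
  -- T]` are fewer than `g T - g a`, and the argument resumes at `T + 1`.
  have key : ∀ d a, a + d = m → a < m → (bad.filter fun u => a ≤ u).card + g a ≤ G := by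
    intro d
    induction d using Nat.strong_induction_on with
    | _ d ih =>
      intro a had ham
      by_cases ha : a ∈ bad
      · obtain ⟨T, h1, h2, h3⟩ := (Finset.mem_filter.1 ha).2
        have hsub : (bad.filter fun u => a ≤ u) ⊆
            (I.filter fun w => a ≤ w ∧ w ≤ T) ∪ (bad.filter fun u => T + 1 ≤ u) := by
          intro u hu
          rw [Finset.mem_filter] at hu
          rw [Finset.mem_union, Finset.mem_filter, Finset.mem_filter]
          rcases Nat.lt_or_ge T u with h | h
          · exact Or.inr ⟨hu.1, h⟩
          · exact Or.inl ⟨(Finset.mem_filter.1 hu.1).1, hu.2, h⟩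
        have hcard := (Finset.card_le_card hsub).trans (Finset.card_union_le _ _)
        rcases Nat.lt_or_ge (T + 1) m with hT | hT
        · have := ih (m - (T + 1)) (by omega) (T + 1) (by omega) hT
          have := hg (Nat.le_succ T)
          simp only [Nat.succ_eq_add_one] at this
          omega
        · have := hend _ hT
          have := hG T h2
          omega
      · have heq : (bad.filter fun u => a ≤ u) = bad.filter fun u => a + 1 ≤ u := by
          refine Finset.filter_congr fun u hu => ?_
          have : u ≠ a := fun h => ha (h ▸ hu)
          omega
        rw [heq]
        rcases Nat.lt_or_ge (a + 1) m with h | h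
        · have := ih (d - 1) (by omega) (a + 1) (by omega) h
          have := hg (Nat.le_succ a)
          simp only [Nat.succ_eq_add_one] at this
          omega
        · have := hend _ h
          have := hG a ham
          omega
  rcases Nat.eq_zero_or_pos m with rfl | hm
  · have := hend 0 le_rfl
    simp only [Nat.zero_le, Finset.filter_true] at this
    omega
  · have := key m 0 (by omega) hm
    simp only [Nat.zero_le, Finset.filter_true] at this
    omega

/-- Elements of `I` with few predecessors in `I`. -/
theorem min_le_card_first (I : Finset ℕ) (r : ℕ) :
    min I.card (r + 1) ≤ (I.filter fun u => (I.filter fun w => w < u).card ≤ r).card := by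
  classical
  set ρ : ℕ → ℕ := fun u => (I.filter fun w => w < u).card
  have hmono : ∀ u ∈ I, ∀ v, u < v → ρ u < ρ v := by
    intro u hu v huv
    refine Finset.card_lt_card ⟨fun w hw => ?_, fun h => ?_⟩
    · rw [Finset.mem_filter] at hw ⊢
      exact ⟨hw.1, by omega⟩
    · have := h (Finset.mem_filter.2 ⟨hu, huv⟩)
      simp at this
  have hinj : Set.InjOn ρ I := by
    intro u hu v hv huv
    rcases lt_trichotomy u v with h | h | h
    · have := hmono u hu v h; omega
    · exact h
    · have := hmono v hv u h; omega
  have himage : I.image ρ = Finset.range I.card := by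
    refine Finset.eq_of_subset_of_card_le ?_ ?_
    · intro c hc
      obtain ⟨u, hu, rfl⟩ := Finset.mem_image.1 hc
      rw [Finset.mem_range]
      refine Finset.card_lt_card ⟨Finset.filter_subset _ _, fun h => ?_⟩
      have := h hu
      simp at this
    · rw [Finset.card_image_of_injOn hinj, Finset.card_range]
  have hsub : Finset.range (min I.card (r + 1)) ⊆
      (I.filter fun u => ρ u ≤ r).image ρ := by
    intro c hc
    rw [Finset.mem_range] at hc
    have : c ∈ I.image ρ := by rw [himage, Finset.mem_range]; omega
    obtain ⟨u, hu, rfl⟩ := Finset.mem_image.1 this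
    exact Finset.mem_image_of_mem _ (Finset.mem_filter.2 ⟨hu, by omega⟩)
  have := (Finset.card_le_card hsub).trans Finset.card_image_le
  rwa [Finset.card_range] at this

/-- Elements of `I` with few successors in `I`. -/
theorem card_last_le (I : Finset ℕ) (M : ℕ) :
    (I.filter fun u => (I.filter fun w => u ≤ w).card ≤ M).card ≤ M := by
  classical
  set ρ : ℕ → ℕ := fun u => (I.filter fun w => u ≤ w).card
  have hmono : ∀ u ∈ I, ∀ v, u < v → ρ v < ρ u := by
    intro u hu v huv
    refine Finset.card_lt_card ⟨fun w hw => ?_, fun h => ?_⟩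
    · rw [Finset.mem_filter] at hw ⊢
      exact ⟨hw.1, by omega⟩
    · have := h (Finset.mem_filter.2 ⟨hu, le_rfl⟩)
      simp at this
      omega
  have hcard : M = (Finset.Icc 1 M).card := by simp
  conv_rhs => rw [hcard]
  refine Finset.card_le_card_of_injOn ρ ?_ ?_
  · intro u hu
    rw [Finset.mem_coe, Finset.mem_filter] at hu
    rw [Finset.mem_coe, Finset.mem_Icc]
    refine ⟨Finset.card_pos.2 ⟨u, ?_⟩, hu.2⟩
    simp [hu.1]
  · intro u hu v hv huv
    rw [Finset.mem_coe, Finset.mem_filter] at hu hv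
    rcases lt_trichotomy u v with h | h | h
    · have := hmono u hu.1 v h; omega
    · exact h
    · have := hmono v hv.1 u h; omega

/-! ### Good times and rivals. -/

namespace Sampler

variable (S : Sampler) (n : ℕ)

/-- The times at which `i` arrives. -/
def times (x : ℕ → ℕ) (m i : ℕ) : Finset ℕ := (Finset.range m).filter fun w => x w = i

theorem card_times (x : ℕ → ℕ) (m i : ℕ) : (times x m i).card = freq x m i := rfl

/-- The toll, in class `h`, of the row of time `τ`. -/
def rowToll (h τ : ℕ) : ℕ := S.totalToll n h (S.row n h τ)

theorem rowToll_mono (h : ℕ) : Monotone (S.rowToll n h) :=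
  fun _ _ hτ => S.totalToll_mono n h (S.row_mono n h hτ)

/-- A time `u` after which the element `x u` always keeps arriving at twice the rate of the tolls of
class `h`. -/
def IsGood (x : ℕ → ℕ) (m h u : ℕ) : Prop :=
  ∀ T, u ≤ T → T < m → 2 * S.rowToll n h T ≤ occ x u (T + 1) + 2 * S.rowToll n h u

/-- The number of arrivals of `x u` since `u` and before the row `l` of class `h`. -/
def occRow (x : ℕ → ℕ) (m h l u : ℕ) : ℕ :=
  ((times x m (x u)).filter fun w => u ≤ w ∧ S.row n h w < l).card

/-- The arrivals of other elements in the row of `u`. -/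
def youngRivals (x : ℕ → ℕ) (m h i u : ℕ) : Finset ℕ :=
  (Finset.range m).filter fun v => x v ≠ i ∧ S.row n h v = S.row n h u

/-- The arrivals of other elements before the row `l` whose counters may be better in this row than
the one that was born at time `u`. -/
def oldRivals (x : ℕ → ℕ) (m h i l u : ℕ) : Finset ℕ :=
  (Finset.range m).filter fun v => x v ≠ i ∧ S.row n h v < l ∧
    S.totalToll n h l ≤ S.rowToll n h v + freq x m (x v) ∧
    S.occRow n x m h l u ≤ 2 * freq x m (x v)

-- The rising sun lemma for twice the toll, whose total growth is at most `2 * 7 * 64 ^ h`.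
open Classical in
theorem card_not_isGood_le (x : ℕ → ℕ) (m h i : ℕ)
    (hm : ∀ t < m, t / S.slotLength n h < 8 ^ S.width n h) :
    ((times x m i).filter fun u => ¬ S.IsGood n x m h u).card ≤ 14 * 64 ^ h := by
  have hbound := card_lt_growth_le (times x m i) (fun t => 2 * S.rowToll n h t)
    (fun _ _ ht => Nat.mul_le_mul_left 2 (S.rowToll_mono n h ht)) m (14 * 64 ^ h) (by
      intro t ht
      have h1 := S.totalToll_le n (h := h) (hm t ht)
      have h2 := S.totalToll_mono n h (rowStart_le (t / S.slotLength n h))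
      have h3 : S.rowToll n h t ≤ 7 * 64 ^ h := h2.trans h1
      omega)
  refine le_trans (Finset.card_le_card fun u hu => ?_) hbound
  rw [Finset.mem_filter] at hu ⊢
  refine ⟨hu.1, ?_⟩
  have hxu : x u = i := (Finset.mem_filter.1 hu.1).2
  have := hu.2
  simp only [IsGood, not_forall, not_le] at this
  obtain ⟨T, h1, h2, h3⟩ := this
  refine ⟨T, h1, h2, lt_of_le_of_lt (Nat.add_le_add_right ?_ _) h3⟩
  refine Finset.card_le_card fun w hw => ?_
  simp only [Finset.mem_filter, times, Finset.mem_Ico, Finset.mem_range] at hw ⊢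
  exact ⟨⟨hw.2.1, by omega⟩, by rw [hw.1.2, hxu]⟩

theorem occ_add_card_lt {x : ℕ → ℕ} {m u : ℕ} :
    occ x u m + ((times x m (x u)).filter fun w => w < u).card = freq x m (x u) := by
  rw [← card_times, ← Finset.card_filter_add_card_filter_not (s := times x m (x u))
    (fun w => u ≤ w)]
  congr 1
  · rw [occ]
    congr 1
    ext w
    simp only [Finset.mem_filter, times, Finset.mem_Ico, Finset.mem_range]
    tauto
  · congr 1
    ext w
    simp

/-- The good times among the first `1 / e` of the arrivals of `i`. -/
noncomputable def goodTimes (x : ℕ → ℕ) (m h i e : ℕ) : Finset ℕ :=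
  open Classical in
  (times x m i).filter fun u => S.IsGood n x m h u ∧
    ((times x m i).filter fun w => w < u).card ≤ freq x m i / e

theorem mem_goodTimes {x : ℕ → ℕ} {m h i e u : ℕ} : u ∈ S.goodTimes n x m h i e ↔
    u ∈ times x m i ∧ S.IsGood n x m h u ∧
      ((times x m i).filter fun w => w < u).card ≤ freq x m i / e := by
  simp only [goodTimes, Finset.mem_filter]

theorem le_card_goodTimes (x : ℕ → ℕ) (m h i e : ℕ) (he : 1 ≤ e)
    (hm : ∀ t < m, t / S.slotLength n h < 8 ^ S.width n h) :
    freq x m i ≤ e * ((S.goodTimes n x m h i e).card + 14 * 64 ^ h) := by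
  classical
  have h1 := min_le_card_first (times x m i) (freq x m i / e)
  have h2 := S.card_not_isGood_le n x m h i hm
  have h3 : ((times x m i).filter fun u => ((times x m i).filter fun w => w < u).card ≤
      freq x m i / e) ⊆ S.goodTimes n x m h i e ∪
        (times x m i).filter fun u => ¬ S.IsGood n x m h u := by
    intro u hu
    rw [Finset.mem_filter] at hu
    rw [Finset.mem_union, mem_goodTimes, Finset.mem_filter]
    by_cases hg : S.IsGood n x m h u
    · exact Or.inl ⟨hu.1, hg, hu.2⟩
    · exact Or.inr ⟨hu.1, hg⟩
  have h4 := (Finset.card_le_card h3).trans (Finset.card_union_le _ _)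
  rw [card_times] at h1
  -- The early arrivals number at least this minimum, and the bad ones among them are at most `14 *
  -- 64 ^ h`.
  have h5 : min (freq x m i) (freq x m i / e + 1) ≤
      (S.goodTimes n x m h i e).card + 14 * 64 ^ h := by
    omega
  refine le_trans ?_ (Nat.mul_le_mul_left e h5)
  rcases min_cases (freq x m i) (freq x m i / e + 1) with ⟨hc, -⟩ | ⟨hc, -⟩
  · rw [hc]
    exact Nat.le_mul_of_pos_left _ he
  · rw [hc]
    exact (Nat.lt_mul_div_succ _ he).le

/-! ### Survival -/

theorem beats_iff {T : ℕ} {y z : Counter} : S.beats n T y z = true ↔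
    (z.1 = y.1 ∧ (z.2.2.2 = S.row n y.1 T ↔ y.2.2.2 = S.row n y.1 T)) ∧
      S.rank n y ≤ S.rank n z := by
  simp only [beats, Bool.and_eq_true, decide_eq_true_eq, beq_iff_eq, decide_eq_decide]

/-- The counter born at a good time `u` survives, if among the hits of its class there are not too
many arrivals of the same element, and not too many rivals. -/
theorem counter_mem_state_of_isGood (x ω : ℕ → ℕ) {m h i u : ℕ} (hh : h ≤ S.top n)
    (hm : ∀ t < m, t / S.slotLength n h < 8 ^ S.width n h) (hu : u ∈ times x m i)
    (hω : ω u % 64 ^ h = 0) (hgood : S.IsGood n x m h u)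
    (hown : 2 * ((hits ω h m).filter fun v => v ∈ times x m i).card ≤ S.minCapacity n h)
    (hyoung : 2 * ((hits ω h m).filter fun v => v ∈ S.youngRivals n x m h i u).card ≤
      S.capacity n h (S.row n h u))
    (hold : ∀ T < m, S.row n h u < S.row n h T →
      2 * ((hits ω h m).filter fun v => v ∈ S.oldRivals n x m h i (S.row n h T) u).card ≤
        S.capacity n h (S.row n h T)) :
    S.counter n x m u h ∈ (S.state n x ω m).2 := by
  have hum : u < m := Finset.mem_range.1 (Finset.mem_filter.1 hu).1
  have hxu : x u = i := (Finset.mem_filter.1 hu).2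
  refine S.counter_mem_state n x ω hh hω (fun T hT1 hT2 => ?_) hum
  have hcap : S.capacity n h (T / S.slotLength n h) = S.capacity n h (S.row n h T) := by
    rw [row, capacity, capacity, if_pos (hm T hT2), if_pos ((rowStart_le _).trans_lt (hm T hT2)),
      log_rowStart]
  have hmin : S.minCapacity n h ≤ S.capacity n h (S.row n h T) := by
    rw [← hcap, capacity, if_pos (hm T hT2)]
    exact Nat.le_mul_of_pos_right _ (by positivity)
  have hrowT : S.row n h u ≤ S.row n h T := S.row_mono n h hT1
  obtain ⟨V, hV, hsub⟩ : ∃ V : Finset ℕ,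
      2 * ((hits ω h m).filter fun v => v ∈ V).card ≤ S.capacity n h (S.row n h T) ∧
      ∀ v < m, v ≤ T → x v ≠ i → S.beats n T (S.counter n x (T + 1) u h)
        (S.counter n x (T + 1) v h) = true → v ∈ V := by
    rcases hrowT.eq_or_lt with hr | hr
    · refine ⟨_, hr ▸ hyoung, fun v hvm hvT hxv hb => ?_⟩
      rw [beats_iff] at hb
      change (h = h ∧ (S.row n h v = S.row n h T ↔ S.row n h u = S.row n h T)) ∧ _ at hb
      simp only [youngRivals, Finset.mem_filter, Finset.mem_range]
      exact ⟨hvm, hxv, (hb.1.2.2 hr).trans hr.symm⟩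
    · refine ⟨_, hold T hT2 hr, fun v hvm hvT hxv hb => ?_⟩
      rw [beats_iff] at hb
      change (h = h ∧ (S.row n h v = S.row n h T ↔ S.row n h u = S.row n h T)) ∧
        occ x u (T + 1) + S.rowToll n h u ≤ occ x v (T + 1) + S.rowToll n h v at hb
      have hvne : S.row n h v ≠ S.row n h T := fun hv => hr.ne (hb.1.2.1 hv)
      have hrowv : S.row n h v < S.row n h T := lt_of_le_of_ne (S.row_mono n h hvT) hvne
      -- Goodness gives `occ u + rowToll u ≥ rowToll T + occ u / 2`. So a rival has `freq + rowToll
      -- v ≥ rowToll T + occ u / 2`, and since `rowToll v ≤ rowToll T`, both conditions on old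
      -- rivals follow.
      have h1 := hb.2
      have h2 := hgood T hT1 hT2
      have h3 := occ_le_freq x v (T + 1)
      have h4 : freq x (T + 1) (x v) ≤ freq x m (x v) :=
        Finset.card_le_card (Finset.filter_subset_filter _ (Finset.range_mono hT2))
      have h5 : S.rowToll n h v ≤ S.rowToll n h T := S.rowToll_mono n h hvT
      have h6 : S.occRow n x m h (S.row n h T) u ≤ occ x u (T + 1) := by
        refine Finset.card_le_card fun w hw => ?_
        simp only [times, Finset.mem_filter, Finset.mem_range, Finset.mem_Ico] at hw ⊢
        refine ⟨⟨hw.2.1, ?_⟩, hw.1.2⟩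
        by_contra hc
        exact absurd hw.2.2 (not_lt.2 (S.row_mono n h (by omega)))
      simp only [oldRivals, Finset.mem_filter, Finset.mem_range]
      refine ⟨hvm, hxv, hrowv, ?_, by omega⟩
      change S.rowToll n h T ≤ _
      omega
  have hfinal : ((hits ω h (T + 1)).filter fun v => S.beats n T (S.counter n x (T + 1) u h)
      (S.counter n x (T + 1) v h) = true) ⊆
      ((hits ω h m).filter fun v => v ∈ times x m i) ∪ ((hits ω h m).filter fun v => v ∈ V) := by
    intro v hv
    simp only [hits, Finset.mem_filter, Finset.mem_range, Finset.mem_union] at hv ⊢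
    by_cases hxv : x v = i
    · exact Or.inl ⟨⟨by omega, hv.1.2⟩, by simp [times, hxv]; omega⟩
    · exact Or.inr ⟨⟨by omega, hv.1.2⟩, hsub v (by omega) (by omega) hxv hv.2⟩
  have := (Finset.card_le_card hfinal).trans (Finset.card_union_le _ _)
  rw [hcap]
  omega

/-- If the capacity exceeds the length of the stream, then nothing is dropped from class `0`. -/
theorem counter_mem_state_of_le (x ω : ℕ → ℕ) {m u : ℕ} (hu : u < m) (hK : m ≤ S.K)
    (hC : m ≤ S.C) : S.counter n x m u 0 ∈ (S.state n x ω m).2 := by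
  refine S.counter_mem_state n x ω (Nat.zero_le _) (by simp [Nat.mod_one]) (fun T _ hT => ?_) hu
  -- In class `0` the slot length is `K` and the first slot has capacity `C`, so the whole stream
  -- lies in slot `0`.
  have hw : S.width n 0 = 0 := by simp [width]
  have hs : T / S.slotLength n 0 = 0 := by
    rw [slotLength, hw]
    exact Nat.div_eq_of_lt (by simpa using hT.trans_le hK)
  rw [hs, capacity, minCapacity, hw]
  simp only [pow_zero, Nat.lt_one_iff, if_true, zero_mul, mul_one, Nat.log_zero_right]
  refine (Finset.card_filter_le _ _).trans ((Finset.card_filter_le _ _).trans ?_)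
  rw [Finset.card_range]
  omega

/-! ### The numbers of rivals -/

/-- The row length and the capacity carry the same factor `2 ^ i`, and slot length and minimal
capacity are in the ratio `K * 64 ^ h` to `C`. -/
theorem card_youngRivals_le (hK : 1 ≤ S.K) (x : ℕ → ℕ) (m h i u : ℕ)
    (hu : u / S.slotLength n h < 8 ^ S.width n h) :
    S.C * (S.youngRivals n x m h i u).card ≤
      S.K * 64 ^ h * S.capacity n h (S.row n h u) := by
  set t := S.slotLength n h with ht
  have htpos : 0 < t := by rw [ht, slotLength]; positivity
  set y := u / t with hy
  have hcard : (S.youngRivals n x m h i u).card ≤ 2 ^ Nat.log 8 y * t := by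
    have : (S.youngRivals n x m h i u) ⊆
        Finset.Ico (rowStart y * t) ((rowStart y + 2 ^ Nat.log 8 y) * t) := by
      intro v hv
      have hv2 : rowStart (v / t) = rowStart y := (Finset.mem_filter.1 hv).2.2
      have h1 : rowStart y ≤ v / t := hv2 ▸ rowStart_le _
      have h2 : v / t < rowStart y + 2 ^ Nat.log 8 y := by
        have := lt_rowStart_add (v / t)
        rwa [← log_rowStart (v / t), hv2, log_rowStart] at this
      rw [Finset.mem_Ico]
      exact ⟨(Nat.le_div_iff_mul_le htpos).1 h1, (Nat.div_lt_iff_lt_mul htpos).1 h2⟩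
    refine (Finset.card_le_card this).trans ?_
    rw [Nat.card_Ico, add_mul]
    omega
  refine (Nat.mul_le_mul_left _ hcard).trans (le_of_eq ?_)
  rw [row, ← ht, ← hy, capacity, if_pos ((rowStart_le y).trans_lt hu), log_rowStart, minCapacity,
    ht, slotLength]
  ring

/-- These are among the last `M` arrivals of `i` before row `l`. -/
theorem card_occRow_le (x : ℕ → ℕ) (m h i l M : ℕ) :
    ((times x m i).filter fun u => S.row n h u < l ∧ S.occRow n x m h l u ≤ M).card ≤ M := by
  refine le_trans (Finset.card_le_card fun u hu => ?_)
    (card_last_le ((times x m i).filter fun u => S.row n h u < l) M)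
  rw [Finset.mem_filter] at hu
  rw [Finset.mem_filter, Finset.mem_filter]
  refine ⟨⟨hu.1, hu.2.1⟩, le_trans (le_of_eq ?_) hu.2.2⟩
  have hxu : x u = i := (Finset.mem_filter.1 hu.1).2
  rw [occRow, hxu, Finset.filter_filter]
  congr 1
  refine Finset.filter_congr fun w _ => ?_
  tauto

/-- The rows in which something arrives. -/
def rows (m h : ℕ) : Finset ℕ := (Finset.range m).image (S.row n h)

/-- At the last row in which `v` can still be a rival, all tolls since the row of `v` sum to at most
`F`, and the sum in question is part of them. -/
theorem sum_toll_rows_le (m h v F : ℕ) :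
    ∑ l ∈ (S.rows n m h).filter (fun l => S.row n h v < l ∧
      S.totalToll n h l ≤ S.rowToll n h v + F), S.toll n h l ≤ F := by
  set A := (S.rows n m h).filter (fun l => S.row n h v < l ∧
      S.totalToll n h l ≤ S.rowToll n h v + F) with hA
  rcases A.eq_empty_or_nonempty with h0 | hne
  · simp [h0]
  · set L := A.max' hne with hLdef
    have hL : S.row n h v < L ∧ S.totalToll n h L ≤ S.rowToll n h v + F :=
      (Finset.mem_filter.1 (A.max'_mem hne)).2
    have hsub : A ⊆ Finset.Ioc (S.row n h v) L := fun l hl =>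
      Finset.mem_Ioc.2 ⟨(Finset.mem_filter.1 hl).2.1, A.le_max' l hl⟩
    have h1 : ∑ l ∈ A, S.toll n h l ≤ ∑ l ∈ Finset.Ioc (S.row n h v) L, S.toll n h l :=
      Finset.sum_le_sum_of_subset hsub
    have h2 := S.sum_toll_Ioc n h _ _ hL.1.le
    have h3 := hL.2
    rw [rowToll] at h3
    omega

/-- The number of the old rivals in all rows together, weighted by the tolls. -/
theorem sum_toll_mul_card_oldRivals_le (x : ℕ → ℕ) (m h i : ℕ) :
    ∑ l ∈ S.rows n m h, ∑ u ∈ (times x m i).filter (fun u => S.row n h u < l),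
      S.toll n h l * (S.oldRivals n x m h i l u).card ≤
    2 * ∑ v ∈ (Finset.range m).filter (fun v => x v ≠ i), freq x m (x v) ^ 2 := by
  have h1 : ∀ l ∈ S.rows n m h, ∑ u ∈ (times x m i).filter (fun u => S.row n h u < l),
      S.toll n h l * (S.oldRivals n x m h i l u).card ≤
      ∑ v ∈ (Finset.range m).filter (fun v => x v ≠ i),
        if S.row n h v < l ∧ S.totalToll n h l ≤ S.rowToll n h v + freq x m (x v) then
          S.toll n h l * (2 * freq x m (x v)) else 0 := by
    intro l _
    have h2 : ∀ u, (S.oldRivals n x m h i l u).card =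
        ∑ v ∈ (Finset.range m).filter (fun v => x v ≠ i),
          if (S.row n h v < l ∧ S.totalToll n h l ≤ S.rowToll n h v + freq x m (x v)) ∧
            S.occRow n x m h l u ≤ 2 * freq x m (x v) then 1 else 0 := by
      intro u
      rw [← Finset.card_filter, oldRivals, Finset.filter_filter]
      congr 1
      refine Finset.filter_congr fun w _ => ?_
      tauto
    simp only [h2]
    -- The order of `u` and `v` is exchanged: for fixed `l` and `v`, at most `2 * freq x m (x v)`
    -- times `u` remain.
    rw [← Finset.mul_sum, Finset.sum_comm, Finset.mul_sum]
    refine Finset.sum_le_sum fun v _ => ?_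
    split_ifs with hc
    · refine Nat.mul_le_mul_left _ ?_
      refine le_trans (le_of_eq ?_) (S.card_occRow_le n x m h i l (2 * freq x m (x v)))
      simp only [hc, and_self, true_and]
      rw [← Finset.card_filter, Finset.filter_filter]
    · simp [hc]
  refine (Finset.sum_le_sum h1).trans ?_
  rw [Finset.sum_comm, Finset.mul_sum]
  refine Finset.sum_le_sum fun v _ => ?_
  rw [← Finset.sum_filter, ← Finset.sum_mul]
  calc _ ≤ freq x m (x v) * (2 * freq x m (x v)) :=
        Nat.mul_le_mul_right _ (S.sum_toll_rows_le n m h v _)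
    _ = _ := by ring

end Sampler

/-! ### Uniform random vectors -/

theorem card_filter_forall_mem {ι α : Type*} [Fintype ι] [DecidableEq ι] [Fintype α]
    [DecidableEq α] [Nonempty α] (A : Finset ι) (Z : Finset α) :
    ((Finset.univ.filter fun ω : ι → α => ∀ t ∈ A, ω t ∈ Z).card : ℝ) =
      ((Z.card : ℝ) / Fintype.card α) ^ A.card * Fintype.card (ι → α) := by
  have h1 : (Finset.univ.filter fun ω : ι → α => ∀ t ∈ A, ω t ∈ Z) =
      Fintype.piFinset fun t => if t ∈ A then Z else Finset.univ := by
    ext ω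
    simp only [Finset.mem_filter, Finset.mem_univ, true_and, Fintype.mem_piFinset]
    refine forall_congr' fun t => ?_
    split_ifs with h <;> simp [h]
  have hα : (Fintype.card α : ℝ) ≠ 0 := by simp
  rw [h1, Fintype.card_piFinset]
  have h2 : ∀ t, (if t ∈ A then Z else Finset.univ).card =
      if t ∈ A then Z.card else Fintype.card α := fun t => by split_ifs <;> simp
  simp only [h2]
  rw [Finset.prod_ite, Finset.prod_const, Finset.prod_const, Fintype.card_fun,
    ← Finset.card_univ (α := ι), ← Finset.card_filter_add_card_filter_not (s := Finset.univ)
      (fun t => t ∈ A)]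
  have h3 : (Finset.univ.filter fun t => t ∈ A) = A := by ext; simp
  rw [h3]
  push_cast
  rw [pow_add, div_pow]
  field_simp

/-- Bernoulli's inequality for `(1 + p) ^ N`, together with `(1 - p) (1 + p) ≤ 1`. -/
theorem one_sub_pow_le {p : ℝ} (h0 : 0 ≤ p) (h1 : p ≤ 1) (N : ℕ) :
    (1 - p) ^ N ≤ 1 / (1 + p * N) := by
  have hpos : 0 < 1 + p * N := by positivity
  rw [le_div_iff₀ hpos]
  have hB : 1 + (N : ℝ) * p ≤ (1 + p) ^ N := one_add_mul_le_pow (by linarith) N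
  calc (1 - p) ^ N * (1 + p * N) ≤ (1 - p) ^ N * (1 + p) ^ N := by
        rw [mul_comm p]
        exact mul_le_mul_of_nonneg_left hB (pow_nonneg (by linarith) _)
    _ = (1 - p ^ 2) ^ N := by rw [← mul_pow]; ring
    _ ≤ 1 := pow_le_one₀ (by nlinarith) (by nlinarith)

/-! ### The probability that all counters born at good times are lost. -/

namespace Sampler

variable (S : Sampler) (n : ℕ)

theorem maxRandom_add_one : S.maxRandom n + 1 = 64 ^ S.top n :=
  Nat.sub_add_cancel (Nat.one_le_pow _ _ (by norm_num))

/-- The vectors of random numbers for a stream of length `m`. -/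
abbrev Randoms (m : ℕ) := Fin m → Fin (S.maxRandom n + 1)

/-- The random numbers that give birth to a counter of class `h`. -/
def hitValues (h : ℕ) : Finset (Fin (S.maxRandom n + 1)) :=
  Finset.univ.filter fun a => (a : ℕ) % 64 ^ h = 0

theorem card_hitValues {h : ℕ} (hh : h ≤ S.top n) :
    ((S.hitValues n h).card : ℝ) / Fintype.card (Fin (S.maxRandom n + 1)) = (64 ^ h)⁻¹ := by
  have hq : S.maxRandom n + 1 = 64 ^ (S.top n - h) * 64 ^ h := by
    rw [← pow_add, Nat.sub_add_cancel hh, maxRandom_add_one]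
  have h64 : 0 < 64 ^ h := by positivity
  have hc : (S.hitValues n h).card = 64 ^ (S.top n - h) := by
    conv_rhs => rw [← Finset.card_range (64 ^ (S.top n - h))]
    refine Finset.card_bij (fun a _ => (a : ℕ) / 64 ^ h) ?_ ?_ ?_
    · intro a _
      rw [Finset.mem_range, Nat.div_lt_iff_lt_mul h64, ← hq]
      exact a.2
    · intro a ha b hb hab
      have ha' := (Finset.mem_filter.1 ha).2
      have hb' := (Finset.mem_filter.1 hb).2
      apply Fin.ext
      have a1 := Nat.div_add_mod (a : ℕ) (64 ^ h)
      have a2 := Nat.div_add_mod (b : ℕ) (64 ^ h)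
      rw [← a1, ← a2, ha', hb', hab]
    · intro c hcm
      rw [Finset.mem_range] at hcm
      refine ⟨⟨c * 64 ^ h, ?_⟩, ?_, ?_⟩
      · rw [hq]
        exact Nat.mul_lt_mul_of_pos_right hcm h64
      · simp [hitValues]
      · simp
  rw [hc, Fintype.card_fin, hq]
  push_cast
  field_simp

variable {S n}

/-- The indicator of a birth in class `h` at time `u`. -/
noncomputable def hit (h : ℕ) {m N : ℕ} (u : ℕ) (ω : Fin m → Fin (N + 1)) : ℝ :=
  if extend ω u % 64 ^ h = 0 then 1 else 0

theorem hit_nonneg (h : ℕ) {m N : ℕ} (u : ℕ) (ω : Fin m → Fin (N + 1)) : 0 ≤ hit h u ω := by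
  unfold hit
  split_ifs <;> norm_num

theorem sum_hit {m h u : ℕ} (hh : h ≤ S.top n) (hu : u < m) :
    ∑ ω : S.Randoms n m, hit h u ω = (64 ^ h)⁻¹ * Fintype.card (S.Randoms n m) := by
  have := card_filter_forall_mem ({⟨u, hu⟩} : Finset (Fin m)) (S.hitValues n h)
  rw [S.card_hitValues n hh, Finset.card_singleton, pow_one] at this
  rw [← this, Finset.card_filter]
  push_cast
  refine Finset.sum_congr rfl fun ω _ => ?_
  simp [hit, extend, hu, hitValues]

theorem sum_hit_mul_hit {m h u v : ℕ} (hh : h ≤ S.top n) (hu : u < m) (hv : v < m) (huv : u ≠ v) :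
    ∑ ω : S.Randoms n m, hit h u ω * hit h v ω =
      ((64 ^ h)⁻¹) ^ 2 * Fintype.card (S.Randoms n m) := by
  have := card_filter_forall_mem ({⟨u, hu⟩, ⟨v, hv⟩} : Finset (Fin m)) (S.hitValues n h)
  rw [S.card_hitValues n hh, Finset.card_pair (by simpa using huv)] at this
  rw [← this, Finset.card_filter]
  push_cast
  refine Finset.sum_congr rfl fun ω _ => ?_
  simp only [hit, extend, hu, hv, dite_true, hitValues, Finset.mem_insert, Finset.mem_singleton,
    forall_eq_or_imp, forall_eq, Finset.mem_filter, Finset.mem_univ, true_and]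
  split_ifs <;> simp_all

theorem card_no_hit_le {m h : ℕ} (hh : h ≤ S.top n) (G : Finset ℕ) (hG : ∀ u ∈ G, u < m) :
    ((Finset.univ.filter fun ω : S.Randoms n m => ∀ u ∈ G, extend ω u % 64 ^ h ≠ 0).card : ℝ) ≤
      1 / (1 + (64 ^ h)⁻¹ * G.card) * Fintype.card (S.Randoms n m) := by
  set A : Finset (Fin m) := Finset.univ.filter fun t => (t : ℕ) ∈ G with hA
  have hAc : A.card = G.card := by
    refine Finset.card_bij (fun t _ => (t : ℕ)) ?_ ?_ ?_
    · intro t ht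
      exact (Finset.mem_filter.1 ht).2
    · intro a _ b _ hab
      exact Fin.ext hab
    · intro u hu
      exact ⟨⟨u, hG u hu⟩, by simp [hA, hu], rfl⟩
  have h1 := card_filter_forall_mem A (S.hitValues n h)ᶜ
  have h2 : (((S.hitValues n h)ᶜ.card : ℝ) / Fintype.card (Fin (S.maxRandom n + 1))) =
      1 - (64 ^ h)⁻¹ := by
    rw [← S.card_hitValues n hh, Finset.card_compl, Nat.cast_sub (Finset.card_le_univ _), sub_div,
      div_self (Nat.cast_ne_zero.2 Fintype.card_ne_zero)]
  rw [h2, hAc] at h1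
  have h3 : (Finset.univ.filter fun ω : S.Randoms n m => ∀ u ∈ G, extend ω u % 64 ^ h ≠ 0) =
      Finset.univ.filter fun ω : S.Randoms n m => ∀ t ∈ A, ω t ∈ (S.hitValues n h)ᶜ := by
    refine Finset.filter_congr fun ω _ => ?_
    constructor
    · intro H t ht
      have := H t (Finset.mem_filter.1 ht).2
      simpa [hitValues, extend] using this
    · intro H u hu
      have := H ⟨u, hG u hu⟩ (by simp [hA, hu])
      simpa [hitValues, extend, hG u hu] using this
  have h4 : ((Finset.univ.filter fun ω : S.Randoms n m =>
      ∀ t ∈ A, ω t ∈ (S.hitValues n h)ᶜ).card : ℝ) =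
      (1 - (64 ^ h)⁻¹) ^ G.card * Fintype.card (S.Randoms n m) := by convert h1
  rw [h3, h4]
  refine mul_le_mul_of_nonneg_right (one_sub_pow_le (by positivity) ?_ _) (by positivity)
  exact inv_le_one_of_one_le₀ (one_le_pow₀ (by norm_num))

theorem card_hits_eq_sum {m h : ℕ} (ω : S.Randoms n m) (V : Finset ℕ) (hV : ∀ v ∈ V, v < m) :
    (((hits (extend ω) h m).filter fun v => v ∈ V).card : ℝ) = ∑ v ∈ V, hit h v ω := by
  have : ((hits (extend ω) h m).filter fun v => v ∈ V) =
      V.filter fun v => extend ω v % 64 ^ h = 0 := by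
    ext v
    simp only [hits, Finset.mem_filter, Finset.mem_range]
    constructor
    · rintro ⟨⟨-, h1⟩, h2⟩
      exact ⟨h2, h1⟩
    · rintro ⟨h1, h2⟩
      exact ⟨⟨hV v h1, h2⟩, h1⟩
  rw [this, Finset.card_filter]
  push_cast
  rfl

variable (S n)

theorem mem_times_lt {x : ℕ → ℕ} {m i u : ℕ} (hu : u ∈ times x m i) : u < m :=
  Finset.mem_range.1 (Finset.mem_filter.1 hu).1

/-- A first moment bound for the event that all counters of `i` that were born at good times have
been dropped. -/
theorem failure_indicator_le (x : ℕ → ℕ) {m h i e : ℕ} (hh : h ≤ S.top n) (hC : 1 ≤ S.C)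
    (hm : ∀ t < m, t / S.slotLength n h < 8 ^ S.width n h) (ω : S.Randoms n m)
    (hfail : ∀ u ∈ S.goodTimes n x m h i e, S.counter n x m u h ∉ (S.state n x (extend ω) m).2) :
    1 ≤ (if ∀ u ∈ S.goodTimes n x m h i e, extend ω u % 64 ^ h ≠ 0 then (1 : ℝ) else 0) +
      2 / S.minCapacity n h * ∑ v ∈ times x m i, hit h v ω +
      ∑ u ∈ times x m i, 2 / (S.capacity n h (S.row n h u) : ℝ) *
        ∑ v ∈ S.youngRivals n x m h i u, hit h u ω * hit h v ω +
      ∑ l ∈ S.rows n m h, ∑ u ∈ (times x m i).filter (fun u => S.row n h u < l),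
        2 / (S.capacity n h l : ℝ) * ∑ v ∈ S.oldRivals n x m h i l u, hit h u ω * hit h v ω := by
  have hcapPos (t : ℕ) (ht : t < m) : 0 < S.capacity n h (S.row n h t) := by
    rw [row, capacity, if_pos ((rowStart_le _).trans_lt (hm t ht)), minCapacity]
    positivity
  have hminPos : 0 < S.minCapacity n h := by rw [minCapacity]; positivity
  have hn1 : 0 ≤ (if ∀ u ∈ S.goodTimes n x m h i e, extend ω u % 64 ^ h ≠ 0
      then (1 : ℝ) else 0) := by split_ifs <;> norm_num
  have hn2 : 0 ≤ 2 / (S.minCapacity n h : ℝ) * ∑ v ∈ times x m i, hit h v ω :=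
    mul_nonneg (by positivity) (Finset.sum_nonneg fun v _ => hit_nonneg h v ω)
  have hn3 : ∀ u ∈ times x m i, 0 ≤ 2 / (S.capacity n h (S.row n h u) : ℝ) *
        ∑ v ∈ S.youngRivals n x m h i u, hit h u ω * hit h v ω := fun u _ =>
    mul_nonneg (by positivity) (Finset.sum_nonneg fun v _ =>
      mul_nonneg (hit_nonneg h u ω) (hit_nonneg h v ω))
  have hn4 : ∀ l u, 0 ≤ 2 / (S.capacity n h l : ℝ) *
        ∑ v ∈ S.oldRivals n x m h i l u, hit h u ω * hit h v ω := fun l u =>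
    mul_nonneg (by positivity) (Finset.sum_nonneg fun v _ =>
      mul_nonneg (hit_nonneg h u ω) (hit_nonneg h v ω))
  have hs3 := Finset.sum_nonneg hn3
  have hs4 : 0 ≤ ∑ l ∈ S.rows n m h, ∑ u ∈ (times x m i).filter (fun u => S.row n h u < l),
        2 / (S.capacity n h l : ℝ) * ∑ v ∈ S.oldRivals n x m h i l u, hit h u ω * hit h v ω :=
    Finset.sum_nonneg fun l _ => Finset.sum_nonneg fun u _ => hn4 l u
  by_cases hnone : ∀ u ∈ S.goodTimes n x m h i e, extend ω u % 64 ^ h ≠ 0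
  · rw [if_pos hnone]
    linarith
  · push Not at hnone
    obtain ⟨u, hu, hω⟩ := hnone
    have hu' := (S.mem_goodTimes n).1 hu
    have hut : u ∈ times x m i := hu'.1
    have hhit : hit h u ω = 1 := by rw [hit, if_pos hω]
    have hlarge {c V : ℕ} (hc : 0 < c) (hcV : c < 2 * V) : (1 : ℝ) ≤ 2 / c * V := by
      rw [div_mul_eq_mul_div, le_div_iff₀ (by exact_mod_cast hc)]
      rw [one_mul]
      exact_mod_cast hcV.le
    by_cases h1 : 2 * ((hits (extend ω) h m).filter fun v => v ∈ times x m i).card ≤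
        S.minCapacity n h
    · by_cases h2 : 2 * ((hits (extend ω) h m).filter
          fun v => v ∈ S.youngRivals n x m h i u).card ≤ S.capacity n h (S.row n h u)
      · have h3 : ¬ ∀ T < m, S.row n h u < S.row n h T →
            2 * ((hits (extend ω) h m).filter fun v =>
              v ∈ S.oldRivals n x m h i (S.row n h T) u).card ≤
              S.capacity n h (S.row n h T) := fun h3 =>
          hfail u hu (S.counter_mem_state_of_isGood n x _ hh hm hut hω hu'.2.1 h1 h2 h3)
        push Not at h3
        obtain ⟨T, hT, hrow, hbig⟩ := h3
        have hle := hlarge (hcapPos T hT) hbig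
        rw [card_hits_eq_sum ω (S.oldRivals n x m h i (S.row n h T) u) fun v hv =>
          Finset.mem_range.1 (Finset.mem_filter.1 hv).1] at hle
        -- The sampled `u` depends on `ω`. Inserting its indicator, which is 1, allows a sum over
        -- all arrivals of `i`, and each product of two indicators has mean `(64 ^ (-h)) ^ 2`.
        have hterm : 1 ≤ 2 / (S.capacity n h (S.row n h T) : ℝ) *
            ∑ v ∈ S.oldRivals n x m h i (S.row n h T) u, hit h u ω * hit h v ω := by
          simpa only [hhit, one_mul] using hle
        have hl : S.row n h T ∈ S.rows n m h :=
          Finset.mem_image_of_mem _ (Finset.mem_range.2 hT)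
        have hum : u ∈ (times x m i).filter (fun u => S.row n h u < S.row n h T) :=
          Finset.mem_filter.2 ⟨hut, hrow⟩
        have := Finset.single_le_sum (f := fun u => 2 / (S.capacity n h (S.row n h T) : ℝ) *
            ∑ v ∈ S.oldRivals n x m h i (S.row n h T) u, hit h u ω * hit h v ω)
            (fun u _ => hn4 _ u) hum
        have := Finset.single_le_sum (f := fun l =>
          ∑ u ∈ (times x m i).filter (fun u => S.row n h u < l), 2 / (S.capacity n h l : ℝ) *
            ∑ v ∈ S.oldRivals n x m h i l u, hit h u ω * hit h v ω)
            (fun l _ => Finset.sum_nonneg fun u _ => hn4 l u) hl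
        linarith
      · have hle := hlarge (hcapPos u (mem_times_lt hut)) (not_le.1 h2)
        rw [card_hits_eq_sum ω (S.youngRivals n x m h i u) fun v hv =>
          Finset.mem_range.1 (Finset.mem_filter.1 hv).1] at hle
        have hterm : 1 ≤ 2 / (S.capacity n h (S.row n h u) : ℝ) *
            ∑ v ∈ S.youngRivals n x m h i u, hit h u ω * hit h v ω := by
          simpa only [hhit, one_mul] using hle
        have := Finset.single_le_sum hn3 hut
        linarith
    · have hle := hlarge hminPos (not_le.1 h1)
      rw [card_hits_eq_sum ω _ fun v hv => mem_times_lt hv] at hle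
      linarith

-- The average of the preceding bound over all random vectors. The four terms stand for no sample at
-- a good time, too many counters of `i` itself, too many young rivals, and too many old rivals.
open Classical in
theorem card_failure_le (x : ℕ → ℕ) {m h i e : ℕ} (hh : h ≤ S.top n) (hC : 1 ≤ S.C)
    (hK : 1 ≤ S.K) (hm : ∀ t < m, t / S.slotLength n h < 8 ^ S.width n h) :
    ((Finset.univ.filter fun ω : S.Randoms n m => ∀ u ∈ S.goodTimes n x m h i e,
      S.counter n x m u h ∉ (S.state n x (extend ω) m).2).card : ℝ) ≤
    (1 / (1 + (64 ^ h)⁻¹ * (S.goodTimes n x m h i e).card) +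
      2 * freq x m i / (S.C * 64 ^ h) + 2 * S.K * freq x m i / (S.C * 64 ^ h) +
      4 * (∑ v ∈ (Finset.range m).filter (fun v => x v ≠ i), freq x m (x v) ^ 2 : ℕ) /
        ((64 ^ h) ^ 2 * (S.minCapacity n h * (4 ^ (3 * h - S.width n h) * 2 ^ S.width n h) : ℕ))) *
      Fintype.card (S.Randoms n m) := by
  set G := S.goodTimes n x m h i e with hG
  set M : ℝ := ((Fintype.card (S.Randoms n m) : ℕ) : ℝ) with hM
  have hMpos : 0 ≤ M := by positivity
  set p : ℝ := (64 ^ h)⁻¹ with hp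
  have hppos : 0 < p := by positivity
  have hCpos : (0 : ℝ) < S.C := by exact_mod_cast hC
  have hgood : ∀ u ∈ G, u < m := fun u hu => mem_times_lt ((S.mem_goodTimes n).1 hu).1
  have hminC : (S.C : ℝ) ≤ S.minCapacity n h := by
    rw [minCapacity]
    exact_mod_cast Nat.le_mul_of_pos_right _ (by positivity)
  have hstep : ((Finset.univ.filter fun ω : S.Randoms n m => ∀ u ∈ G,
      S.counter n x m u h ∉ (S.state n x (extend ω) m).2).card : ℝ) ≤
      ∑ ω : S.Randoms n m, ((if ∀ u ∈ G, extend ω u % 64 ^ h ≠ 0 then (1 : ℝ) else 0) +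
      2 / S.minCapacity n h * ∑ v ∈ times x m i, hit h v ω +
      ∑ u ∈ times x m i, 2 / (S.capacity n h (S.row n h u) : ℝ) *
        ∑ v ∈ S.youngRivals n x m h i u, hit h u ω * hit h v ω +
      ∑ l ∈ S.rows n m h, ∑ u ∈ (times x m i).filter (fun u => S.row n h u < l),
        2 / (S.capacity n h l : ℝ) *
          ∑ v ∈ S.oldRivals n x m h i l u, hit h u ω * hit h v ω) := by
    rw [Finset.card_filter]
    push_cast
    refine Finset.sum_le_sum fun ω _ => ?_
    split_ifs with hf hf'
    · have := S.failure_indicator_le n x hh hC hm ω hf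
      rwa [if_pos hf'] at this
    · have := S.failure_indicator_le n x hh hC hm ω hf
      rwa [if_neg hf'] at this
    all_goals
      refine add_nonneg (add_nonneg (add_nonneg (by norm_num) ?_) ?_) ?_
      · exact mul_nonneg (by positivity) (Finset.sum_nonneg fun v _ => hit_nonneg h v ω)
      · exact Finset.sum_nonneg fun u _ => mul_nonneg (by positivity) (Finset.sum_nonneg fun v _ =>
          mul_nonneg (hit_nonneg h u ω) (hit_nonneg h v ω))
      · exact Finset.sum_nonneg fun l _ => Finset.sum_nonneg fun u _ => mul_nonneg (by positivity)
          (Finset.sum_nonneg fun v _ => mul_nonneg (hit_nonneg h u ω) (hit_nonneg h v ω))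
  refine hstep.trans ?_
  rw [Finset.sum_add_distrib, Finset.sum_add_distrib, Finset.sum_add_distrib, add_mul, add_mul,
    add_mul]
  have hpair {c : ℝ} {u : ℕ} {V : Finset ℕ} (hu : u < m) (hV : ∀ v ∈ V, v < m ∧ v ≠ u) :
      ∑ ω : S.Randoms n m, c * ∑ v ∈ V, hit h u ω * hit h v ω = c * (V.card * (p ^ 2 * M)) := by
    rw [← Finset.mul_sum, Finset.sum_comm]
    rw [Finset.sum_congr rfl fun v hv => sum_hit_mul_hit hh hu (hV v hv).1 (hV v hv).2.symm]
    rw [Finset.sum_const, nsmul_eq_mul]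
  refine add_le_add (add_le_add (add_le_add ?_ ?_) ?_) ?_
  · have := card_no_hit_le (S := S) (n := n) (m := m) hh G hgood
    rw [Finset.card_filter] at this
    push_cast at this
    refine le_trans (le_of_eq ?_) this
    refine Finset.sum_congr rfl fun ω _ => ?_
    congr
  · rw [← Finset.mul_sum, Finset.sum_comm,
      Finset.sum_congr rfl fun v hv => sum_hit hh (mem_times_lt hv), Finset.sum_const,
      nsmul_eq_mul, card_times]
    calc 2 / (S.minCapacity n h : ℝ) * (freq x m i * (p * M)) ≤
          2 / S.C * (freq x m i * (p * M)) := by gcongr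
      _ = _ := by rw [hp]; field_simp
  · rw [Finset.sum_comm]
    have hterm : ∀ u ∈ times x m i, ∑ ω : S.Randoms n m,
        2 / (S.capacity n h (S.row n h u) : ℝ) *
          ∑ v ∈ S.youngRivals n x m h i u, hit h u ω * hit h v ω ≤ 2 * S.K * p / S.C * M := by
      intro u hu
      have hum := mem_times_lt hu
      have hxu : x u = i := (Finset.mem_filter.1 hu).2
      rw [hpair (V := S.youngRivals n x m h i u) hum fun v hv =>
        ⟨Finset.mem_range.1 (Finset.mem_filter.1 hv).1, fun hvu => (Finset.mem_filter.1 hv).2.1 (hvu ▸ hxu)⟩]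
      have hcap : (0 : ℝ) < S.capacity n h (S.row n h u) := by
        rw [row, capacity, if_pos ((rowStart_le _).trans_lt (hm u hum)), minCapacity]
        exact_mod_cast (by positivity)
      have hcard : (S.C : ℝ) * (S.youngRivals n x m h i u).card ≤
          S.K * 64 ^ h * S.capacity n h (S.row n h u) := by
        exact_mod_cast S.card_youngRivals_le n hK x m h i u (hm u hum)
      have hY : ((S.youngRivals n x m h i u).card : ℝ) / S.capacity n h (S.row n h u) ≤
          S.K * 64 ^ h / S.C := by
        rw [div_le_div_iff₀ hcap hCpos]
        linarith
      calc _ = ((S.youngRivals n x m h i u).card : ℝ) / S.capacity n h (S.row n h u) *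
            (2 * p ^ 2 * M) := by ring
        _ ≤ S.K * 64 ^ h / S.C * (2 * p ^ 2 * M) := by gcongr
        _ = _ := by rw [hp]; field_simp
    refine (Finset.sum_le_sum hterm).trans (le_of_eq ?_)
    rw [Finset.sum_const, nsmul_eq_mul, card_times, hp]
    field_simp
  · set W : ℕ := S.minCapacity n h * (4 ^ (3 * h - S.width n h) * 2 ^ S.width n h) with hW
    have hWpos : (0 : ℝ) < W := by
      rw [hW, minCapacity]
      exact_mod_cast (by positivity)
    have hl : ∀ l ∈ S.rows n m h, ∑ ω : S.Randoms n m,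
        ∑ u ∈ (times x m i).filter (fun u => S.row n h u < l), 2 / (S.capacity n h l : ℝ) *
          ∑ v ∈ S.oldRivals n x m h i l u, hit h u ω * hit h v ω =
        2 * p ^ 2 * M / W * (∑ u ∈ (times x m i).filter (fun u => S.row n h u < l),
          S.toll n h l * (S.oldRivals n x m h i l u).card : ℕ) := by
      intro l hl
      obtain ⟨T, hT, rfl⟩ := Finset.mem_image.1 hl
      -- Hence `2 / capacity` equals `2 * toll / W` in every row, and the sum over the rows becomes
      -- the sum weighted by tolls.
      have hct : S.capacity n h (S.row n h T) * S.toll n h (S.row n h T) = W :=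
        S.capacity_mul_toll n (hm T (Finset.mem_range.1 hT))
      have hct' : (S.capacity n h (S.row n h T) : ℝ) * S.toll n h (S.row n h T) = W := by
        exact_mod_cast hct
      have hcap : (S.capacity n h (S.row n h T) : ℝ) ≠ 0 := fun h0 => by
        rw [h0, zero_mul] at hct'
        exact hWpos.ne hct'
      rw [Finset.sum_comm]
      push_cast
      rw [Finset.mul_sum]
      refine Finset.sum_congr rfl fun u hu => ?_
      have hut := (Finset.mem_filter.1 hu).1
      have hxu : x u = i := (Finset.mem_filter.1 hut).2
      rw [hpair (V := S.oldRivals n x m h i (S.row n h T) u) (mem_times_lt hut) fun v hv =>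
        ⟨Finset.mem_range.1 (Finset.mem_filter.1 hv).1,
        fun hvu => (Finset.mem_filter.1 hv).2.1 (hvu ▸ hxu)⟩, ← hct']
      have htoll : (S.toll n h (S.row n h T) : ℝ) ≠ 0 := fun h0 => by
        rw [h0, mul_zero] at hct'
        exact hWpos.ne hct'
      field_simp
    rw [Finset.sum_comm, Finset.sum_congr rfl hl, ← Finset.mul_sum]
    have hsum : ((∑ l ∈ S.rows n m h, ∑ u ∈ (times x m i).filter (fun u => S.row n h u < l),
      S.toll n h l * (S.oldRivals n x m h i l u).card : ℕ) : ℝ) ≤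
      (2 * ∑ v ∈ (Finset.range m).filter (fun v => x v ≠ i), freq x m (x v) ^ 2 : ℕ) := by
      exact_mod_cast S.sum_toll_mul_card_oldRivals_le n x m h i
    have hcast : ∑ l ∈ S.rows n m h, ((∑ u ∈ (times x m i).filter (fun u => S.row n h u < l),
      S.toll n h l * (S.oldRivals n x m h i l u).card : ℕ) : ℝ) =
      ((∑ l ∈ S.rows n m h, ∑ u ∈ (times x m i).filter (fun u => S.row n h u < l),
      S.toll n h l * (S.oldRivals n x m h i l u).card : ℕ) : ℝ) := by push_cast; rfl
    rw [hcast]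
    calc _ ≤ 2 * p ^ 2 * M / W *
          (2 * ∑ v ∈ (Finset.range m).filter (fun v => x v ≠ i), freq x m (x v) ^ 2 : ℕ) := by
          gcongr
      _ = _ := by
          rw [hp]
          push_cast
          field_simp
          ring

end Sampler

/-! ### A criterion for success, and interpolation of power sums. -/

open Classical in
theorem PMF.two_thirds_le_toOuterMeasure_map {Ω β : Type} [Fintype Ω] [Nonempty Ω] (g : Ω → β)
    (s : Set β) (B : Finset Ω) (hB : (B.card : ℝ) ≤ 1 / 3 * Fintype.card Ω)
    (hg : ∀ ω, ω ∉ B → g ω ∈ s) :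
    2 / 3 ≤ ((PMF.uniformOfFintype Ω).map g).toOuterMeasure s := by
  rw [PMF.toOuterMeasure_map_apply, PMF.toOuterMeasure_uniformOfFintype_apply]
  have h1 : Bᶜ.card ≤ Fintype.card (g ⁻¹' s) := by
    rw [← Set.toFinset_card]
    refine Finset.card_le_card fun ω hω => ?_
    rw [Set.mem_toFinset]
    exact hg ω (Finset.mem_compl.1 hω)
  have h2 : 2 * Fintype.card Ω ≤ Fintype.card (g ⁻¹' s) * 3 := by
    have h3 : 3 * B.card ≤ Fintype.card Ω := by
      have : (3 * B.card : ℝ) ≤ Fintype.card Ω := by linarith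
      exact_mod_cast this
    rw [Finset.card_compl] at h1
    omega
  rw [ENNReal.le_div_iff_mul_le (Or.inl (by simp)) (Or.inl (by simp)), ← ENNReal.mul_div_right_comm,
    ENNReal.div_le_iff_le_mul (Or.inl (by simp)) (Or.inl (by simp))]
  exact_mod_cast h2

/-- If the `k`-th powers sum up to at most `f ^ k` and there are at most `N ^ k` terms, then the
smaller powers are bounded as by interpolation. -/
theorem sum_pow_le_of_sum_pow_le {ι : Type*} (s : Finset ι) (g : ι → ℕ) {k q f N : ℕ} (hq : 1 ≤ q)
    (hqk : q ≤ k) (hN : 1 ≤ N) (hsum : ∑ j ∈ s, g j ^ k ≤ f ^ k)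
    (hcard : (s.filter fun j => 0 < g j).card ≤ N ^ k) (hf : 1 ≤ f) :
    ∑ j ∈ s, g j ^ q ≤ 2 * N ^ (k - q) * f ^ q := by
  have hN' : (0 : ℝ) < N := by exact_mod_cast hN
  have hf' : (0 : ℝ) < f := by exact_mod_cast hf
  have hc : (0 : ℝ) < f / N := by positivity
  -- The threshold `c = f / N` balances the two cases: values below it contribute at most `c ^ q`
  -- each, and a value above it satisfies `g ^ q ≤ g ^ k / c ^ (k - q)`.
  have hpt : ∀ j ∈ s, (g j : ℝ) ^ q ≤
      (if 0 < g j then ((f : ℝ) / N) ^ q else 0) + (g j : ℝ) ^ k / ((f : ℝ) / N) ^ (k - q) := by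
    intro j _
    split_ifs with hj
    · rcases le_total (g j : ℝ) (f / N) with h | h
      · have : (g j : ℝ) ^ q ≤ ((f : ℝ) / N) ^ q := by gcongr
        have : 0 ≤ (g j : ℝ) ^ k / ((f : ℝ) / N) ^ (k - q) := by positivity
        linarith
      · have : (g j : ℝ) ^ q ≤ (g j : ℝ) ^ k / ((f : ℝ) / N) ^ (k - q) := by
          rw [le_div_iff₀ (by positivity), ← Nat.add_sub_cancel' hqk, pow_add,
            Nat.add_sub_cancel_left]
          gcongr
        have : 0 ≤ ((f : ℝ) / N) ^ q := by positivity
        linarith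
    · have : g j = 0 := by omega
      rw [this]
      simp [show q ≠ 0 by omega, show k ≠ 0 by omega]
  have h1 := Finset.sum_le_sum hpt
  rw [Finset.sum_add_distrib, ← Finset.sum_filter, Finset.sum_const, nsmul_eq_mul,
    ← Finset.sum_div] at h1
  have hsum' : ∑ j ∈ s, (g j : ℝ) ^ k ≤ (f : ℝ) ^ k := by exact_mod_cast hsum
  have hcard' : ((s.filter fun j => 0 < g j).card : ℝ) ≤ (N : ℝ) ^ k := by exact_mod_cast hcard
  have h2 : ∑ j ∈ s, (g j : ℝ) ^ q ≤ (N : ℝ) ^ k * ((f : ℝ) / N) ^ q +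
      (f : ℝ) ^ k / ((f : ℝ) / N) ^ (k - q) := h1.trans (by gcongr)
  have h3 : (N : ℝ) ^ k * ((f : ℝ) / N) ^ q + (f : ℝ) ^ k / ((f : ℝ) / N) ^ (k - q) =
      2 * N ^ (k - q) * f ^ q := by
    rw [div_pow, div_pow]
    have hk (t : ℝ) : t ^ k = t ^ q * t ^ (k - q) := by rw [← pow_add, Nat.add_sub_cancel' hqk]
    rw [hk N, hk f]
    field_simp
    ring
  rw [h3] at h2
  exact_mod_cast h2

namespace Sampler

variable (S : Sampler) (n : ℕ)

/-! ### Frequencies -/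

theorem count_map_range (x : ℕ → ℕ) (m j : ℕ) : ((List.range m).map x).count j = freq x m j := by
  induction m with
  | zero => simp [freq]
  | succ m ih =>
    rw [List.range_succ, List.map_append, List.count_append, ih, freq, freq,
      Finset.range_add_one, Finset.filter_insert]
    by_cases h : x m = j
    · simp [h]
    · simp [h]

/-- With `F = 1` this gives the length of the stream; with the squared frequency, sums over arrivals
become third moments. -/
theorem sum_filter_ne_eq (x F : ℕ → ℕ) {m i : ℕ} (hx : ∀ t < m, x t ∈ Finset.Icc 1 n) :
    ∑ v ∈ (Finset.range m).filter (fun v => x v ≠ i), F (x v) =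
      ∑ j ∈ (Finset.Icc 1 n).erase i, freq x m j * F j := by
  rw [← Finset.sum_fiberwise_of_maps_to (t := (Finset.Icc 1 n).erase i) (g := x)]
  · refine Finset.sum_congr rfl fun j hj => ?_
    rw [freq, ← smul_eq_mul, ← Finset.sum_const, Finset.filter_filter]
    refine Finset.sum_congr (Finset.filter_congr fun v _ => ?_) fun v hv => ?_
    · have := (Finset.mem_erase.1 hj).1
      constructor
      · exact fun h => h.2
      · exact fun h => ⟨h ▸ this, h⟩
    · rw [(Finset.mem_filter.1 hv).2]
  · intro v hv
    rw [Finset.mem_filter, Finset.mem_range] at hv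
    exact Finset.mem_erase.2 ⟨hv.2, hx v hv.1⟩

theorem eq_freq_add_sum_freq (x : ℕ → ℕ) {m i : ℕ} (hx : ∀ t < m, x t ∈ Finset.Icc 1 n) :
    m = freq x m i + ∑ j ∈ (Finset.Icc 1 n).erase i, freq x m j := by
  have h1 := sum_filter_ne_eq n x (fun _ => 1) (i := i) hx
  simp only [mul_one] at h1
  rw [← h1, freq, ← Finset.card_eq_sum_ones, Finset.card_filter_add_card_filter_not,
    Finset.card_range]

section Heavy

variable {S n} {x : ℕ → ℕ} {m i : ℕ}

/-- The heaviness of `i` in the stream `x 0, …, x (m - 1)`. -/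
def HeavyIn (k n : ℕ) (x : ℕ → ℕ) (m i : ℕ) : Prop :=
  100 * ∑ j ∈ (Finset.Icc 1 n).erase i, freq x m j ^ k < freq x m i ^ k

theorem HeavyIn.sum_pow_le {k : ℕ} (H : HeavyIn k n x m i) :
    ∑ j ∈ (Finset.Icc 1 n).erase i, freq x m j ^ k ≤ freq x m i ^ k := by
  unfold HeavyIn at H
  omega

theorem HeavyIn.one_le_freq {k : ℕ} (hk : 1 ≤ k) (H : HeavyIn k n x m i) : 1 ≤ freq x m i := by
  by_contra h
  have h0 : freq x m i = 0 := by omega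
  unfold HeavyIn at H
  rw [h0, zero_pow (by omega)] at H
  omega

/-- The number of other elements that occur is at most `n ≤ 4 ^ (k * base)` if the width is `base`.
If it is `3 h`, each of them adds at least 1 to a sum bounded by the `k`-th power of the frequency
of `i`. -/
theorem HeavyIn.sum_freq_pow_le (H : HeavyIn S.k n x m i) (hk : 3 ≤ S.k) {h M q : ℕ} (hM : 1 ≤ M)
    (hf : freq x m i < M * 64 ^ h) (hq : 1 ≤ q) (hqk : q ≤ S.k) :
    ∑ j ∈ (Finset.Icc 1 n).erase i, freq x m j ^ q ≤
      2 * (M * 4 ^ S.width n h) ^ (S.k - q) * freq x m i ^ q := by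
  refine sum_pow_le_of_sum_pow_le _ _ hq hqk (Nat.mul_pos hM (by positivity)) H.sum_pow_le ?_
    (H.one_le_freq (by omega))
  rcases Nat.lt_or_ge (S.base n) (3 * h) with hh | hh
  · have hw : S.width n h = S.base n := min_eq_right hh.le
    rw [hw]
    refine (Finset.card_filter_le _ _).trans ((Finset.card_erase_le).trans ?_)
    rw [Nat.card_Icc, Nat.add_sub_cancel, mul_pow]
    refine (S.le_pow_base n hk).trans ?_
    rw [mul_comm S.k, pow_mul]
    exact Nat.le_mul_of_pos_left _ (by positivity)
  · have hw : S.width n h = 3 * h := min_eq_left hh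
    rw [hw, pow_mul, show (4 : ℕ) ^ 3 = 64 by norm_num]
    refine le_trans ?_ (H.sum_pow_le.trans (Nat.pow_le_pow_left hf.le _))
    rw [Finset.card_filter]
    refine Finset.sum_le_sum fun j _ => ?_
    split_ifs with hj
    · exact Nat.one_le_pow _ _ hj
    · exact Nat.zero_le _

/-- Interpolation with `q = 1`. The stream of a heavy element in the range of class `h` ends before
the capacity of the class drops to 0. -/
theorem HeavyIn.length_lt (H : HeavyIn S.k n x m i) (hk : 3 ≤ S.k)
    (hx : ∀ t < m, x t ∈ Finset.Icc 1 n) {h M : ℕ} (hM : 1 ≤ M) (hK : S.K = 3 * M ^ S.k)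
    (hf : freq x m i < M * 64 ^ h) : m < S.slotLength n h * 8 ^ S.width n h := by
  have h1 := H.sum_freq_pow_le hk hM hf le_rfl (by omega)
  simp only [pow_one] at h1
  have h2 := eq_freq_add_sum_freq n x (i := i) hx
  set N := M * 4 ^ S.width n h with hN
  have hNpos : 1 ≤ N ^ (S.k - 1) := Nat.one_le_pow _ _ (Nat.mul_pos hM (by positivity))
  have h3 : m ≤ 3 * N ^ (S.k - 1) * freq x m i := by nlinarith
  refine h3.trans_lt ((Nat.mul_lt_mul_of_pos_left hf (by positivity)).trans_le (le_of_eq ?_))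
  rw [slotLength, hK, hN, mul_pow]
  obtain ⟨j, hj⟩ : ∃ j, S.k = j + 3 := ⟨S.k - 3, by omega⟩
  rw [hj, show j + 3 - 1 = j + 2 by omega, show 2 * (j + 3) - 5 = 2 * j + 1 by omega]
  have e8 : (8 : ℕ) ^ S.width n h = (2 ^ S.width n h) ^ 3 := by
    rw [← pow_mul, mul_comm, pow_mul]; norm_num
  have e4 : (4 : ℕ) ^ S.width n h = (2 ^ S.width n h) ^ 2 := by
    rw [← pow_mul, mul_comm, pow_mul]; norm_num
  rw [e8, e4, pow_mul]
  ring

/-- Interpolation with `q = 3`; the powers of 2 depending on the width cancel exactly, leaving a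
ratio that depends only on `M`, `k` and `C`. -/
theorem HeavyIn.sum_freq_sq_le (H : HeavyIn S.k n x m i) (hk : 3 ≤ S.k)
    (hx : ∀ t < m, x t ∈ Finset.Icc 1 n) {h M : ℕ} (hM : 1 ≤ M)
    (hf : freq x m i < M * 64 ^ h) :
    S.C * ∑ v ∈ (Finset.range m).filter (fun v => x v ≠ i), freq x m (x v) ^ 2 ≤
      2 * M ^ S.k * ((64 ^ h) ^ 2 *
        (S.minCapacity n h * (4 ^ (3 * h - S.width n h) * 2 ^ S.width n h))) := by
  have h1 := H.sum_freq_pow_le hk hM hf (show 1 ≤ 3 by norm_num) hk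
  rw [sum_filter_ne_eq n x (fun j => freq x m j ^ 2) hx]
  simp only [← pow_succ']
  refine (Nat.mul_le_mul_left _ (h1.trans (Nat.mul_le_mul_left _
    (Nat.pow_le_pow_left hf.le 3)))).trans (le_of_eq ?_)
  rw [minCapacity, mul_pow M, mul_pow M]
  obtain ⟨j, hj⟩ : ∃ j, S.k = j + 3 := ⟨S.k - 3, by omega⟩
  rw [hj, show j + 3 - 3 = j by omega, show 2 * (j + 3) - 5 = 2 * j + 1 by omega]
  have e64 := S.four_pow_mul n h
  have e4 : (4 : ℕ) ^ S.width n h = (2 ^ S.width n h) ^ 2 := by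
    rw [← pow_mul, mul_comm, pow_mul]; norm_num
  rw [e4] at e64 ⊢
  rw [← e64, pow_mul]
  ring

/-- If a counter of a heavy element `i`, born among the first `1 / e` of its arrivals, survives, then
the answer is correct. -/
theorem HeavyIn.best_state_eq {k : ℕ} (H : HeavyIn k n x m i) (hk : 1 ≤ k) {e : ℕ}
    (he : 2 * k ≤ e) (hi : ∀ t < m, x t ∈ Finset.Icc 1 n) {ω : ℕ → ℕ} {u h : ℕ} (hu : u ∈ times x m i)
    (hearly : ((times x m i).filter fun w => w < u).card ≤ freq x m i / e)
    (hmem : S.counter n x m u h ∈ (S.state n x ω m).2) :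
    (best (S.state n x ω m).2).1 = i ∧
      (freq x m i : ℝ) - freq x m i / e ≤ (best (S.state n x ω m).2).2 := by
  have hxu : x u = i := (Finset.mem_filter.1 hu).2
  have h1 := le_best hmem
  change occ x u m ≤ _ at h1
  have h2 := occ_add_card_lt (x := x) (m := m) (u := u)
  rw [hxu] at h2
  have h3 := H.one_le_freq hk
  have hepos : (0 : ℝ) < e := by exact_mod_cast (by omega : 0 < e)
  have h4 : (freq x m i : ℝ) - freq x m i / e ≤ (best (S.state n x ω m).2).2 := by
    have a1 : ((freq x m i / e : ℕ) : ℝ) ≤ (freq x m i : ℝ) / e := Nat.cast_div_le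
    have a2 : freq x m i ≤ (best (S.state n x ω m).2).2 + freq x m i / e := by omega
    have a3 : (freq x m i : ℝ) ≤ (best (S.state n x ω m).2).2 + (freq x m i / e : ℕ) := by
      exact_mod_cast a2
    linarith
  refine ⟨?_, h4⟩
  have hfpos : (0 : ℝ) < freq x m i := by exact_mod_cast h3
  have hke : (k : ℝ) / e ≤ 1 / 2 := by
    rw [div_le_div_iff₀ hepos two_pos]
    exact_mod_cast (by omega : k * 2 ≤ 1 * e)
  have h1e : (1 : ℝ) / e ≤ 1 / 2 := by
    refine le_trans ?_ hke
    gcongr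
    exact_mod_cast hk
  -- The default answer `(1, 0)` is excluded because the output is at least half the positive
  -- frequency of `i`.
  rcases S.best_state n x ω m with hb | ⟨u', hu', hb1, hb2⟩
  · rw [hb] at h4
    have : (freq x m i : ℝ) / e = freq x m i * (1 / e) := by ring
    simp only [Nat.cast_zero] at h4
    nlinarith
  · by_contra hne
    rw [hb1] at hne
    have b1 : (freq x m i : ℝ) * (1 - 1 / e) ≤ freq x m (x u') := by
      have : ((best (S.state n x ω m).2).2 : ℝ) ≤ freq x m (x u') := by exact_mod_cast hb2
      have e1 : (freq x m i : ℝ) * (1 - 1 / e) = freq x m i - freq x m i / e := by ring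
      linarith
    -- Bernoulli with `k / e ≤ 1 / 2`: another element in the answer would have a `k`-th power of at
    -- least half that of `i`, against the factor 100.
    have b2 : (1 / 2 : ℝ) ≤ (1 - 1 / e) ^ k := by
      have := one_add_mul_le_pow (show (-2 : ℝ) ≤ -(1 / e) by linarith) k
      have e1 : (k : ℝ) * -(1 / e) = -(k / e) := by ring
      rw [e1, ← sub_eq_add_neg, ← sub_eq_add_neg] at this
      linarith
    have b3 : ((freq x m i : ℝ) * (1 - 1 / e)) ^ k ≤ (freq x m (x u') : ℝ) ^ k := by
      refine pow_le_pow_left₀ (mul_nonneg hfpos.le (by linarith)) b1 k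
    rw [mul_pow] at b3
    have b4 : freq x m (x u') ^ k ≤ ∑ j ∈ (Finset.Icc 1 n).erase i, freq x m j ^ k :=
      Finset.single_le_sum (f := fun j => freq x m j ^ k) (fun _ _ => Nat.zero_le _)
        (Finset.mem_erase.2 ⟨hne, hi u' hu'⟩)
    have b5 : 100 * freq x m (x u') ^ k < freq x m i ^ k := by
      unfold HeavyIn at H
      omega
    have b6 : (100 : ℝ) * (freq x m (x u') : ℝ) ^ k < (freq x m i : ℝ) ^ k := by exact_mod_cast b5
    have b7 : (0 : ℝ) < (freq x m i : ℝ) ^ k := by positivity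
    nlinarith

end Heavy

end Sampler

/-! ### Choice of the constants and probability of success. -/

namespace Sampler

variable (S : Sampler) (n : ℕ)

/-- The sampler for the precision `1 / e`. -/
def ofPrecision (k a e : ℕ) : Sampler where
  k := k
  a := a
  -- `28 e` is `e` times twice the 14 of the bad arrivals, and 64 is the ratio between classes. `K`
  -- is what the length bound requires, and `C` is so much larger than `K` that the rivals' terms
  -- are small.
  K := 3 * (64 * (28 * e)) ^ k
  C := 2000 * (28 * e) * (3 * (64 * (28 * e)) ^ k)

variable {n}

/-- All counters of a heavy element of frequency about `28 e * 64 ^ h` that are born at good times in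
class `h` are dropped with probability at most `1 / 3`. -/
theorem HeavyIn.card_failure_le {x : ℕ → ℕ} {m i k a e h : ℕ} (H : HeavyIn k n x m i)
    (hk : 3 ≤ k) (he : 1 ≤ e) (hx : ∀ t < m, x t ∈ Finset.Icc 1 n)
    (hh : h ≤ (ofPrecision k a e).top n) (hl : 28 * e * 64 ^ h ≤ freq x m i)
    (hu : freq x m i < 64 * (28 * e) * 64 ^ h) :
    (((Finset.univ.filter fun ω : (ofPrecision k a e).Randoms n m =>
      ∀ u ∈ (ofPrecision k a e).goodTimes n x m h i e, (ofPrecision k a e).counter n x m u h ∉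
        ((ofPrecision k a e).state n x (extend ω) m).2).card : ℕ) : ℝ) ≤
      1 / 3 * Fintype.card ((ofPrecision k a e).Randoms n m) := by
  set S := ofPrecision k a e with hS
  set M := 64 * (28 * e) with hM
  have hSK : S.K = 3 * M ^ k := rfl
  have hSC : S.C = 2000 * (28 * e) * S.K := rfl
  have hM1 : 1 ≤ M := by omega
  have hMk : 1 ≤ M ^ k := Nat.one_le_pow _ _ hM1
  have hK1 : 1 ≤ S.K := by omega
  have hC1 : 1 ≤ S.C := by
    rw [hSC]
    exact Nat.mul_pos (by omega) hK1
  have hm : ∀ t < m, t / S.slotLength n h < 8 ^ S.width n h := fun t ht => by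
    rw [Nat.div_lt_iff_lt_mul (by rw [slotLength]; positivity), mul_comm]
    exact ht.trans (HeavyIn.length_lt (S := S) H hk hx hM1 hSK hu)
  have hsq := HeavyIn.sum_freq_sq_le (S := S) H hk hx hM1 hu
  have hgood := S.le_card_goodTimes n x m h i e he hm
  have hG : 14 * 64 ^ h ≤ (S.goodTimes n x m h i e).card := by
    have h1 : e * (28 * 64 ^ h) ≤ e * ((S.goodTimes n x m h i e).card + 14 * 64 ^ h) :=
      le_trans (le_of_eq (by ring)) (hl.trans hgood)
    have := Nat.le_of_mul_le_mul_left h1 he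
    omega
  refine le_trans (le_of_eq ?_) ((Sampler.card_failure_le S n x (e := e) (i := i) hh hC1 hK1
    hm).trans (mul_le_mul_of_nonneg_right ?_ (Nat.cast_nonneg _)))
  · congr
  · set G := (S.goodTimes n x m h i e).card
    set F := ∑ v ∈ (Finset.range m).filter (fun v => x v ≠ i), freq x m (x v) ^ 2
    set W := S.minCapacity n h * (4 ^ (3 * h - S.width n h) * 2 ^ S.width n h) with hW
    have hWpos : (0 : ℝ) < W := by
      rw [hW, minCapacity]
      exact_mod_cast (by positivity)
    have h64 : (0 : ℝ) < 64 ^ h := by positivity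
    have hepos : (1 : ℝ) ≤ e := by exact_mod_cast he
    have hKpos : (1 : ℝ) ≤ S.K := by exact_mod_cast hK1
    have hCpos : (0 : ℝ) < S.C := by exact_mod_cast hC1
    have hG' : (14 : ℝ) * 64 ^ h ≤ G := by exact_mod_cast hG
    have hu' : (freq x m i : ℝ) ≤ 64 * (28 * e) * 64 ^ h := by exact_mod_cast hu.le
    have hSC' : (S.C : ℝ) = 2000 * (28 * e) * S.K := by rw [hSC]; push_cast; ring
    have hSK' : (S.K : ℝ) = 3 * M ^ k := by rw [hSK]; push_cast; ring
    have hsq' : (S.C : ℝ) * F ≤ 2 * M ^ k * ((64 ^ h) ^ 2 * W) := by exact_mod_cast hsq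
    -- The four terms add up to at most `1/15 + 64/1000 + 64/1000 + 1/100 < 1/3`.
    have t1 : 1 / (1 + ((64 : ℝ) ^ h)⁻¹ * G) ≤ 1 / 15 := by
      refine one_div_le_one_div_of_le (by norm_num) ?_
      have : (14 : ℝ) ≤ ((64 : ℝ) ^ h)⁻¹ * G := by
        rw [inv_mul_eq_div, le_div_iff₀ h64]
        exact hG'
      linarith
    have t3 : 2 * (S.K : ℝ) * freq x m i / (S.C * 64 ^ h) ≤ 64 / 1000 := by
      rw [div_le_div_iff₀ (by positivity) (by norm_num), hSC']
      have := mul_le_mul_of_nonneg_left hu' (show (0 : ℝ) ≤ 2 * S.K by positivity)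
      linarith
    have t2 : 2 * (freq x m i : ℝ) / (S.C * 64 ^ h) ≤ 64 / 1000 := by
      refine le_trans ?_ t3
      gcongr
      linarith
    have t4 : 4 * (F : ℝ) / ((64 ^ h) ^ 2 * W) ≤ 1 / 100 := by
      rw [div_le_div_iff₀ (by positivity) (by norm_num)]
      have h1 : (56000 * (3 * (M : ℝ) ^ k)) * F ≤ 2 * M ^ k * ((64 ^ h) ^ 2 * W) := by
        refine le_trans ?_ hsq'
        rw [hSC', hSK']
        gcongr
        linarith
      have h2 : (0 : ℝ) < M ^ k := by exact_mod_cast hMk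
      have h3 : (M : ℝ) ^ k * (168000 * F) ≤ M ^ k * (2 * ((64 ^ h) ^ 2 * W)) := by linarith
      have h4 := le_of_mul_le_mul_left h3 h2
      have : (0 : ℝ) ≤ F := Nat.cast_nonneg _
      linarith
    linarith

theorem HeavyIn.two_thirds_le {x : ℕ → ℕ} {m i k a e : ℕ} (H : HeavyIn k n x m i)
    (hk : 3 ≤ k) (he : 2 * k ≤ e) (hx : ∀ t < m, x t ∈ Finset.Icc 1 n) (hm : m ≤ n ^ a) :
    2 / 3 ≤ ((ofPrecision k a e).algorithm.answer n ((List.range m).map x)).toOuterMeasure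
      {o | o.1 = i ∧ (freq x m i : ℝ) - freq x m i / e ≤ (o.2 : ℝ)} := by
  classical
  set S := ofPrecision k a e with hS
  have hf1 := H.one_le_freq (by omega)
  rw [S.answer_eq n x m]
  -- A heavy element of small frequency forces `m ≤ K`; then class `0` keeps every counter and the
  -- answer is right for all random numbers.
  rcases Nat.lt_or_ge (freq x m i) (28 * e) with hf | hf
  · refine PMF.two_thirds_le_toOuterMeasure_map _ _ ∅
      (by rw [Finset.card_empty, Nat.cast_zero]; positivity) fun ω _ => ?_
    have hne : (times x m i).Nonempty := Finset.card_pos.1 hf1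
    have hu := (times x m i).min'_mem hne
    set u := (times x m i).min' hne
    have hmlen : m ≤ S.K := by
      have h1 := eq_freq_add_sum_freq n x (i := i) hx
      have h2 : ∑ j ∈ (Finset.Icc 1 n).erase i, freq x m j ≤
          ∑ j ∈ (Finset.Icc 1 n).erase i, freq x m j ^ k :=
        Finset.sum_le_sum fun j _ => Nat.le_self_pow (by omega) _
      have h3 := H.sum_pow_le
      have h4 : freq x m i ≤ freq x m i ^ k := Nat.le_self_pow (by omega) _
      have h5 : freq x m i ^ k ≤ (64 * (28 * e)) ^ k := Nat.pow_le_pow_left (by omega) _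
      have h6 : S.K = 3 * (64 * (28 * e)) ^ k := rfl
      omega
    have hKC : S.K ≤ S.C := Nat.le_mul_of_pos_left _ (by omega)
    refine H.best_state_eq (S := S) (h := 0) (by omega) he hx hu ?_
      (S.counter_mem_state_of_le n x _ (mem_times_lt hu) hmlen (hmlen.trans hKC))
    rw [Finset.filter_eq_empty_iff.2 fun w hw => not_lt.2 ((times x m i).min'_le w hw)]
    exact Nat.zero_le _
  · set h := Nat.log 64 (freq x m i / (28 * e)) with hh
    have he0 : 0 < 28 * e := by omega
    have hq : freq x m i / (28 * e) ≠ 0 := (Nat.div_pos hf he0).ne'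
    have hl : 28 * e * 64 ^ h ≤ freq x m i := by
      rw [mul_comm]
      exact (Nat.le_div_iff_mul_le he0).1 (Nat.pow_log_le_self 64 hq)
    have hu : freq x m i < 64 * (28 * e) * 64 ^ h := by
      have := (Nat.div_lt_iff_lt_mul he0).1 (Nat.lt_pow_succ_log_self (b := 64) (by norm_num)
        (freq x m i / (28 * e)))
      refine this.trans_le (le_of_eq ?_)
      rw [Nat.succ_eq_add_one, pow_succ]
      ring
    -- Here the bound `m ≤ n ^ a` enters: the class that fits the frequency exists.
    have htop : h ≤ S.top n := by
      have h1 : 4 ^ h ≤ 4 ^ S.top n := by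
        calc 4 ^ h ≤ 64 ^ h := Nat.pow_le_pow_left (by norm_num) h
          _ ≤ 28 * e * 64 ^ h := Nat.le_mul_of_pos_left _ he0
          _ ≤ freq x m i := hl
          _ ≤ m := (Finset.card_filter_le _ _).trans (Finset.card_range m).le
          _ ≤ n ^ a := hm
          _ ≤ (4 ^ (S.k * S.base n)) ^ a := Nat.pow_le_pow_left (S.le_pow_base n hk) a
          _ = 4 ^ S.top n := by
            rw [← pow_mul]
            congr 1
            change k * S.base n * a = a * k * S.base n
            ring
      exact (Nat.pow_le_pow_iff_right (by norm_num)).1 h1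
    refine PMF.two_thirds_le_toOuterMeasure_map _ _ _
      (H.card_failure_le hk (by omega) hx htop hl hu) fun ω hω => ?_
    rw [Finset.mem_filter] at hω
    push Not at hω
    obtain ⟨u, hu, hmem⟩ := hω (Finset.mem_univ _)
    have hu' := (S.mem_goodTimes n).1 hu
    exact H.best_state_eq (S := S) (by omega) he hx hu'.1 hu'.2.2 hmem

/-! ### The space bound -/

/-- By minimality of `base`, `4 ^ (k (base - 1)) < n`, so rounding costs a factor of at most `4 ^
k`. -/
theorem base_le_log (hk : 3 ≤ S.k) (hn : 2 ≤ n) :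
    (S.base n : ℝ) ≤ 3 * Real.log n ∧
      (2 : ℝ) ^ (S.base n * (2 * S.k - 4)) ≤ 4 ^ S.k * (n : ℝ) ^ (1 - 2 / (S.k : ℝ)) := by
  set b := S.base n with hb
  have h4k : 1 < 4 ^ S.k := Nat.one_lt_pow (by omega) (by norm_num)
  have hb1 : 1 ≤ b := Nat.clog_pos h4k hn
  have hlt : (4 ^ S.k) ^ (b - 1) < n := Nat.pow_pred_clog_lt_self h4k (by omega)
  have hn' : (2 : ℝ) ≤ n := by exact_mod_cast hn
  have hk' : (3 : ℝ) ≤ S.k := by exact_mod_cast hk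
  have hlog2 : (1 / 2 : ℝ) ≤ Real.log n := by
    have := Real.log_two_gt_d9
    have := Real.log_le_log (by norm_num) hn'
    linarith
  constructor
  · have h1 : 2 ^ (2 * (b - 1)) ≤ n := by
      refine le_trans ?_ hlt.le
      rw [pow_mul]
      exact Nat.pow_le_pow_left (Nat.le_self_pow (by omega) 4) _
    have h2 : (2 : ℝ) ^ (2 * (b - 1)) ≤ n := by exact_mod_cast h1
    have h3 := Real.log_le_log (by positivity) h2
    rw [Real.log_pow] at h3
    push_cast [Nat.cast_sub hb1] at h3
    have := Real.log_two_gt_d9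
    have hb1' : (1 : ℝ) ≤ b := by exact_mod_cast hb1
    nlinarith
  · have h1 : (4 : ℝ) ^ (S.k * b) ≤ 4 ^ S.k * n := by
      have : (4 ^ S.k) ^ b ≤ 4 ^ S.k * n := by
        obtain ⟨c, hc⟩ : ∃ c, b = c + 1 := ⟨b - 1, by omega⟩
        rw [hc, Nat.add_sub_cancel] at hlt
        rw [hc, pow_succ, mul_comm]
        exact Nat.mul_le_mul_left _ hlt.le
      rw [pow_mul]
      exact_mod_cast this
    have hq0 : 0 ≤ 1 - 2 / (S.k : ℝ) := by
      rw [sub_nonneg, div_le_one (by linarith)]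
      linarith
    have hq1 : 1 - 2 / (S.k : ℝ) ≤ 1 := by
      have : 0 ≤ 2 / (S.k : ℝ) := by positivity
      linarith
    -- The exponents agree: `2 k b (1 - 2/k) = b (2 k - 4)`.
    have h2 : (2 : ℝ) ^ (b * (2 * S.k - 4)) = ((4 : ℝ) ^ (S.k * b)) ^ (1 - 2 / (S.k : ℝ)) := by
      rw [show (4 : ℝ) = 2 ^ 2 by norm_num, ← pow_mul, ← Real.rpow_natCast 2 (2 * (S.k * b)),
        ← Real.rpow_mul (by norm_num), ← Real.rpow_natCast]
      congr 1
      push_cast [Nat.cast_sub (show 4 ≤ 2 * S.k by omega)]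
      field_simp
      ring
    rw [h2]
    refine (Real.rpow_le_rpow (by positivity) h1 hq0).trans ?_
    rw [Real.mul_rpow (by positivity) (by positivity)]
    refine mul_le_mul_of_nonneg_right ?_ (by positivity)
    exact Real.rpow_le_self_of_one_le (one_le_pow₀ (by norm_num)) hq1

/-- The constant in the space bound. -/
def spaceConstant : ℝ :=
  (2 * S.C * (S.a * S.k + 5) + 1) * 4 ^ S.k * ((32 * S.k * (S.a + 1) + 19) * 3)

theorem length_toBits_le_spaceConstant_mul (hk : 3 ≤ S.k) (hn : 2 ≤ n) (x ω : ℕ → ℕ) (T : ℕ)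
    (hx : ∀ t < T, x t ≤ n) (hT : T ≤ n ^ S.a) :
    ((Counter.toBits (S.state n x ω T)).length : ℝ) ≤
      S.spaceConstant * ((n : ℝ) ^ (1 - 2 / (S.k : ℝ)) * Real.log n) := by
  obtain ⟨h1, h2⟩ := S.base_le_log hk hn
  have h3 : ((Counter.toBits (S.state n x ω T)).length : ℝ) ≤
      (2 * S.C * (S.a * S.k + 5) + 1) * 2 ^ (S.base n * (2 * S.k - 4)) *
        ((32 * S.k * (S.a + 1) + 19) * S.base n) := by
    exact_mod_cast S.length_toBits_le n hk x ω T hx hT hn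
  refine h3.trans ?_
  calc _ ≤ (2 * S.C * (S.a * S.k + 5) + 1) * (4 ^ S.k * (n : ℝ) ^ (1 - 2 / (S.k : ℝ))) *
        ((32 * S.k * (S.a + 1) + 19) * (3 * Real.log n)) := by gcongr
    _ = _ := by rw [spaceConstant]; ring

end Sampler

/-! ### The theorem. -/

theorem theorem3 (k : ℕ) (hk : 3 ≤ k) (ε : ℝ) (hε : 0 < ε) (a : ℕ) :
    ∃ A : StreamingAlgorithm, ∃ C : ℝ, 0 < C ∧
      ∀ n : ℕ, 2 ≤ n → ∀ D : List ℕ, IsStream n D → D.length ≤ n ^ a →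
        A.UsesAtMostBits n D (C * ((n : ℝ) ^ (1 - 2 / (k : ℝ)) * Real.log n)) ∧
        (∀ o ∈ (A.answer n D).support, o.1 ∈ Finset.Icc 1 n ∧ o.2 ≤ frequency D o.1) ∧
        (∀ i : ℕ, IsHeavy k n D i →
          2 / 3 ≤ (A.answer n D).toOuterMeasure
            {o | o.1 = i ∧ (1 - ε) * (frequency D i : ℝ) ≤ (o.2 : ℝ)}) := by
  -- `1 / e ≤ ε` gives the precision, and `2 k ≤ e` lets the largest counter identify the heavy
  -- element.
  obtain ⟨e, he⟩ := exists_nat_ge (max (1 / ε) (2 * k))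
  have heε : 1 / ε ≤ e := (le_max_left _ _).trans he
  have hek : 2 * k ≤ e := by exact_mod_cast (le_max_right _ _).trans he
  set S := Sampler.ofPrecision k a e with hS
  refine ⟨S.algorithm, S.spaceConstant, by rw [Sampler.spaceConstant]; positivity,
    fun n hn D hD hlen => ?_⟩
  -- The default value `0` is used only beyond the end of the stream and is never read.
  have hlist (L : List ℕ) : (List.range L.length).map (fun t => L.getD t 0) = L := by
    refine List.ext_getElem (by simp) fun t h1 h2 => ?_
    simp [h2]
  have hmem (L : List ℕ) (hL : IsStream n L) (t : ℕ) (ht : t < L.length) :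
      L.getD t 0 ∈ Finset.Icc 1 n := by
    rw [List.getD_eq_getElem _ _ ht]
    exact hL _ (List.getElem_mem ht)
  have hfreq (j : ℕ) : frequency D j = Sampler.freq (fun t => D.getD t 0) D.length j := by
    rw [← Sampler.count_map_range, hlist]
    rfl
  refine ⟨fun D' hD' w hw => ?_, fun o ho => ?_, fun i hi => ?_⟩
  · rw [← hlist D', S.run_eq, PMF.support_map] at hw
    obtain ⟨ω, -, rfl⟩ := hw
    exact S.length_toBits_le_spaceConstant_mul hk hn _ _ _
      (fun t ht => (Finset.mem_Icc.1 (hmem D' (fun p hp => hD p (hD'.subset hp)) t ht)).2)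
      (hD'.length_le.trans hlen)
  · rw [← hlist D, S.answer_eq, PMF.support_map] at ho
    obtain ⟨ω, -, rfl⟩ := ho
    beta_reduce
    rcases S.best_state n (fun t => D.getD t 0) (Sampler.extend ω) D.length with
      h | ⟨u, hu, h1, h2⟩
    · rw [h]
      exact ⟨Finset.mem_Icc.2 ⟨le_rfl, by omega⟩, Nat.zero_le _⟩
    · rw [hfreq, h1]
      exact ⟨hmem D hD u hu, h2⟩
  · have H : Sampler.HeavyIn k n (fun t => D.getD t 0) D.length i := by
      have := hi.2
      simp only [hfreq] at this
      exact this
    have h1 := H.two_thirds_le (a := a) hk hek (hmem D hD) hlen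
    rw [hlist D] at h1
    refine h1.trans (MeasureTheory.measure_mono ?_)
    rintro o ⟨h2, h3⟩
    refine ⟨h2, le_trans ?_ h3⟩
    rw [hfreq]
    have h4 : (1 : ℝ) / e ≤ ε := by
      have he0 : (0 : ℝ) < e := lt_of_lt_of_le (by positivity) heε
      rw [div_le_iff₀ he0]
      rwa [div_le_iff₀ hε, mul_comm] at heε
    have h5 := mul_le_mul_of_nonneg_left h4
      (Nat.cast_nonneg (α := ℝ) (Sampler.freq (fun t => D.getD t 0) D.length i))
    have e1 : (Sampler.freq (fun t => D.getD t 0) D.length i : ℝ) / e =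
      Sampler.freq (fun t => D.getD t 0) D.length i * (1 / e) := by ring
    linarith
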